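/- Let $n\ge 0$ and $r\ge 1$ be integers, let $\star\in\{\top,\mathsf H\}$ denote either the transpose or the conjugate transpose, and let $A_k,B_k,C_k,D_k\in\mathbb C^{n\times n}$ for $k=1,\dots,r$. Consider the periodic system $$A_kX_kB_k-C_kX_{k+1}D_k=E_k\quad(k=1,\dots,r-1),\qquad A_rX_rB_r-C_rX_1^{\star}D_r=E_r$$ in the unknowns $X_1,\dots,X_r\in\mathbb C^{n\times n}$. It is called nonsingular if it has exactly one solution for every choice of the right-hand sides $E_1,\dots,E_r\in\mathbb C^{n\times n}$. Let $\mathcal Q(\lambda)$ be the $2rn\times 2rn$ pencil, partitioned into $2r\times 2r$ blocks of size $n\times n$, whose diagonal blocks are $\lambda A_1,\dots,\lambda A_r,\lambda B_1^\star,\dots,\lambda B_r^\star$, whose blocks immediately to the right of the diagonal are $C_1,\dots,C_r,D_1^\star,\dots,D_{r-1}^\star$, whose bottom left block is $-D_r^\star$, and whose other blocks are zero. The pencil is regular if $\det\mathcal Q(\lambda)$ is not identically zero. In this case its spectrum $\Lambda(\mathcal Q)\subseteq\mathbb C\cup\{\infty\}$ consists of all $\lambda\in\mathbb C$ for which $\mathcal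 Q(\lambda)$ is singular, together with $\infty$ if $\deg\det\mathcal Q(\lambda)<2rn$; the multiplicity of $\xi\in\mathbb C$ is its multiplicity as a root of $\det\mathcal Q(\lambda)$ (zero if it is not a root). With the conventions $0^{-1}=\infty$, $\infty^{-1}=0$, $\overline\infty=\infty$, a set $\mathcal S\subseteq\mathbb C\cup\{\infty\}$ is called reciprocal free if $\lambda\ne\mu^{-1}$ for all $\lambda,\mu\in\mathcal S$, and $\mathsf H$-reciprocal free if $\lambda\neq(\overline\mu)^{-1}$ for all $\lambda,\mu\in\mathcal S$ (the case $\lambda=\mu$ included in both). Let $\mathfrak R_{2r}=\{e^{2\pi \mathfrak i j/(2r)} : j=0,\dots,2r-1\}$. Then the system is nonsingular if and only if $\mathcal Q(\lambda)$ is regular and - if $\star=\mathsf H$, then $\Lambda(\mathcal Q)$ is $\mathsf H$-reciprocal free; - if $\star=\top$, then $\Lambda(\mathcal Q)\setminus\mathfrak R_{2r}$ is reciprocal free and every $\xi\in\mathfrak R_{2r}$ has multiplicity at most $1$. -/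

import Mathlib

noncomputable section

namespace PeriodicSylvester

/-- The two possible meanings of the symbol `⋆`: transpose or conjugate transpose. -/
inductive StarOp : Type
  | transpose
  | conjTranspose

/-- The matrix `M^⋆`. -/
def StarOp.app {n : ℕ} : StarOp → Matrix (Fin n) (Fin n) ℂ → Matrix (Fin n) (Fin n) ℂ
  | .transpose, M => M.transpose
  | .conjTranspose, M => M.conjTranspose

/-- `X = (X_1, …, X_r)` (indexed from `0` to `r - 1` here) solves the periodic system
`A_k X_k B_k - C_k X_{k+1} D_k = E_k` for `k = 1, …, r - 1` and
`A_r X_r B_r - C_r X_1^⋆ D_r = E_r`. -/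
def IsSolution {n r : ℕ} (s : StarOp) (A B C D E X : Fin r → Matrix (Fin n) (Fin n) ℂ) : Prop :=
  ∀ k : Fin r,
    A k * X k * B k
      - C k * (if h : k.val + 1 < r then X ⟨k.val + 1, h⟩ else s.app (X ⟨0, k.pos⟩)) * D k
      = E k

/-- The periodic system is nonsingular: it has exactly one solution for every right-hand side. -/
def IsNonsingularSystem {n r : ℕ} (s : StarOp)
    (A B C D : Fin r → Matrix (Fin n) (Fin n) ℂ) : Prop :=
  ∀ E : Fin r → Matrix (Fin n) (Fin n) ℂ,
    ∃! X : Fin r → Matrix (Fin n) (Fin n) ℂ, IsSolution s A B C D E X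

/-- The `2rn × 2rn` block pencil `Q(λ)`, as a matrix of polynomials in `λ`. Its `2r` diagonal
blocks are `λ A_1, …, λ A_r, λ B_1^⋆, …, λ B_r^⋆`, the blocks directly to the right of the
diagonal are `C_1, …, C_r, D_1^⋆, …, D_{r-1}^⋆`, the bottom left block is `-D_r^⋆`, and all
other blocks vanish. -/
def blockPencil {n r : ℕ} (s : StarOp) (A B C D : Fin r → Matrix (Fin n) (Fin n) ℂ) :
    Matrix (Fin (r + r) × Fin n) (Fin (r + r) × Fin n) (Polynomial ℂ) :=
  Matrix.of fun p q =>
    if q.1 = p.1 then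
      Polynomial.X * Polynomial.C (Fin.append A (fun k => s.app (B k)) p.1 p.2 q.2)
    else if q.1.val = p.1.val + 1 then
      Polynomial.C (Fin.append C (fun k => s.app (D k)) p.1 p.2 q.2)
    else if p.1.val + 1 = r + r ∧ q.1.val = 0 then
      - Polynomial.C (Fin.append C (fun k => s.app (D k)) p.1 p.2 q.2)
    else 0

/-- A square pencil is regular if its determinant is not identically zero. -/
def IsRegularPencil {ι : Type*} [Fintype ι] [DecidableEq ι]
    (Q : Matrix ι ι (Polynomial ℂ)) : Prop :=
  Q.det ≠ 0

/-- The spectrum of a (regular) pencil, a subset of `ℂ ∪ {∞}`: the finite `z` for which `Q(z)` is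
singular, together with `∞` if the degree of `det Q` is smaller than the size of the pencil. -/
def pencilSpectrum {ι : Type*} [Fintype ι] [DecidableEq ι]
    (Q : Matrix ι ι (Polynomial ℂ)) : Set (OnePoint ℂ) :=
  {w | (∃ z : ℂ, w = (z : OnePoint ℂ) ∧ (Q.map (Polynomial.eval z)).det = 0) ∨
    (w = OnePoint.infty ∧ Q.det.degree < (Fintype.card ι : WithBot ℕ))}

/-- The (algebraic) multiplicity of the finite value `z` as an eigenvalue of a regular pencil. -/
def pencilMultiplicity {ι : Type*} [Fintype ι] [DecidableEq ι]
    (Q : Matrix ι ι (Polynomial ℂ)) (z : ℂ) : ℕ :=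
  Q.det.rootMultiplicity z

/-- Inversion on `ℂ ∪ {∞}`, with `0⁻¹ = ∞` and `∞⁻¹ = 0`. -/
def extInv : OnePoint ℂ → OnePoint ℂ
  | none => ((0 : ℂ) : OnePoint ℂ)
  | some z => if z = 0 then OnePoint.infty else ((z⁻¹ : ℂ) : OnePoint ℂ)

/-- Complex conjugation on `ℂ ∪ {∞}`, with `∞` fixed. -/
def extConj : OnePoint ℂ → OnePoint ℂ
  | none => OnePoint.infty
  | some z => ((starRingEnd ℂ z : ℂ) : OnePoint ℂ)

/-- `S` is reciprocal free: `x ≠ y⁻¹` for all `x, y ∈ S` (including `x = y`). -/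
def IsReciprocalFree (S : Set (OnePoint ℂ)) : Prop :=
  ∀ x ∈ S, ∀ y ∈ S, x ≠ extInv y

/-- `S` is `H`-reciprocal free: `x ≠ (conj y)⁻¹` for all `x, y ∈ S` (including `x = y`). -/
def IsHReciprocalFree (S : Set (OnePoint ℂ)) : Prop :=
  ∀ x ∈ S, ∀ y ∈ S, x ≠ extInv (extConj y)

/-- The set of `p`-th roots of unity `exp (2 π i j / p)`, `j = 0, …, p - 1`. -/
def unityRoots (p : ℕ) : Set ℂ :=
  {z | ∃ j : ℕ, j < p ∧ z = Complex.exp (2 * (Real.pi : ℂ) * Complex.I * (j : ℂ) / (p : ℂ))}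

end PeriodicSylvester

end

/-! Put `F = (A_1, …, A_r, B_1^⋆, …, B_r^⋆)` and `G = (C_1, …, C_r, D_1^⋆, …, D_r^⋆)`, indexed
modulo `2r`. With `Y_{k+r} = Y_k^⋆`, the system together with its starred equations reads `F_k Y_k
F_{k+r}^⋆ - G_k Y_{k+1} G_{k+r}^⋆ = E_k` (`isSolution_iff`). It keeps this form under `F_k ↦ P_k F_k
Q_k`, `G_k ↦ P_k G_k Q_{k+1}`, so all `F_k`, `G_k` may be taken upper triangular
(`exists_triangular`).

Let `a_i`, `c_i` be the products over `k` of the `i`-th diagonal entries. Entry `(i, j)` of the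
triangular equation involves only entries of `Y` at positions `≥ (i, j)`, so the system splits into
scalar cyclic ones. These are nonsingular iff `a_i a_j^⋆ ≠ c_i c_j^⋆`, except that for `⊤` and `i =
j` the symmetry halves the cycle and the condition is `a_i ≠ c_i`
(`isNonsingularSystem_iff_isSeparated`).

The same triangular form gives `det Q(λ) = κ ∏ (a_i λ^{2r} + c_i)` with `κ ≠ 0` (`det_blockPencil`).
What remains is to read the inequalities as statements on the roots of these binomials
(`forall_isSeparated_conjTranspose_iff`, `forall_isSeparated_transpose_iff`). -/

noncomputable section
namespace PeriodicSylvester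
open Matrix

/-! ### Generalized periodic Schur form -/

/-- Two vectors lie on a common line. -/
def OnCommonLine {n : ℕ} (x y : Fin n → ℂ) : Prop :=
  ∃ w : Fin n → ℂ, w ≠ 0 ∧ ∃ a b : ℂ, x = a • w ∧ y = b • w

theorem OnCommonLine.symm {n : ℕ} {x y : Fin n → ℂ} (h : OnCommonLine x y) :
    OnCommonLine y x := by
  obtain ⟨w, hw, a, b, hx, hy⟩ := h
  exact ⟨w, hw, b, a, hy, hx⟩

theorem onCommonLine_zero_right {n : ℕ} (x : Fin (n + 1) → ℂ) : OnCommonLine x 0 := by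
  by_cases hx : x = 0
  · exact ⟨fun _ => 1, fun h => one_ne_zero (congrFun h 0), 0, 0, by simp [hx], by simp⟩
  · exact ⟨x, hx, 1, 0, by simp, by simp⟩

theorem exists_ne_zero_mulVec_eq_zero {n : ℕ} {M : Matrix (Fin n) (Fin n) ℂ} (h : M.det = 0) :
    ∃ v : Fin n → ℂ, v ≠ 0 ∧ M *ᵥ v = 0 :=
  Matrix.exists_mulVec_eq_zero_iff.2 h

/-- A vector can always be continued one step forwards. -/
theorem exists_onCommonLine_mulVec {n : ℕ} (x : Fin (n + 1) → ℂ)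
    (M : Matrix (Fin (n + 1)) (Fin (n + 1)) ℂ) :
    ∃ y : Fin (n + 1) → ℂ, y ≠ 0 ∧ OnCommonLine x (M *ᵥ y) := by
  by_cases hM : M.det = 0
  · obtain ⟨y, hy, h⟩ := exists_ne_zero_mulVec_eq_zero hM
    exact ⟨y, hy, h ▸ onCommonLine_zero_right x⟩
  · by_cases hx : x = 0
    · exact ⟨fun _ => 1, fun h => one_ne_zero (congrFun h 0),
        hx ▸ (onCommonLine_zero_right _).symm⟩
    · have hM' : IsUnit M.det := isUnit_iff_ne_zero.2 hM
      have hy : M *ᵥ (M⁻¹ *ᵥ x) = x := by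
        rw [mulVec_mulVec, mul_nonsing_inv _ hM', one_mulVec]
      refine ⟨M⁻¹ *ᵥ x, ?_, x, hx, 1, 1, by simp, by simp [hy]⟩
      intro h
      rw [h, mulVec_zero] at hy
      exact hx hy.symm

theorem fin_add_one_eq_zero {m : ℕ} [NeZero m] {j : Fin m} (h : j.val + 1 = m) : j + 1 = 0 := by
  apply Fin.ext
  rw [Fin.val_add]
  rcases m with _ | _ | m
  · exact absurd rfl (NeZero.ne 0)
  · simp
  · simp [h]

/-- A sequence whose consecutive terms are related, and whose `m`-th relation closes up, gives a
cyclic family. -/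
theorem exists_cyclic_family {α : Type*} {m : ℕ} [NeZero m] (R : Fin m → α → α → Prop)
    (u : ℕ → α) (k₀ : Fin m)
    (hstep : ∀ j : Fin m, j.val + 1 < m → R (k₀ + j) (u j) (u (j + 1)))
    (hlast : ∀ j : Fin m, j.val + 1 = m → R (k₀ + j) (u j) (u 0)) :
    ∃ v : Fin m → α, (∀ k, ∃ j, v k = u j) ∧ ∀ k, R k (v k) (v (k + 1)) := by
  refine ⟨fun k => u (k - k₀).val, fun k => ⟨_, rfl⟩, fun k => ?_⟩
  have hk : k = k₀ + (k - k₀) := by abel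
  have hk1 : k + 1 - k₀ = (k - k₀) + 1 := by abel
  simp only [hk1]
  generalize k - k₀ = j at *
  subst hk
  rcases Nat.lt_or_ge (j.val + 1) m with h | h
  · rw [Fin.val_add_one_of_lt' h]
    exact hstep j h
  · have h' : j.val + 1 = m := by omega
    rw [fin_add_one_eq_zero h']
    exact hlast j h'

/-- Start at index `k₁ + 1` with a kernel vector of `C k₁` and continue forwards. The relation that
closes the cycle is the one at `k₁`, and it is free because its right-hand vector is `0`. -/
theorem exists_lines_of_det_eq_zero {n m : ℕ} [NeZero m]
    (A C : Fin m → Matrix (Fin (n + 1)) (Fin (n + 1)) ℂ) (k₁ : Fin m) (h₁ : (C k₁).det = 0) :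
    ∃ v : Fin m → Fin (n + 1) → ℂ, (∀ k, v k ≠ 0) ∧
      ∀ k, OnCommonLine (A k *ᵥ v k) (C k *ᵥ v (k + 1)) := by
  obtain ⟨v₀, hv₀, hC⟩ := exists_ne_zero_mulVec_eq_zero h₁
  choose next hnext hline using fun (j : ℕ) (x : Fin (n + 1) → ℂ) =>
    exists_onCommonLine_mulVec (A (k₁ + 1 + Fin.ofNat m j) *ᵥ x) (C (k₁ + 1 + Fin.ofNat m j))
  let u : ℕ → Fin (n + 1) → ℂ := fun j => Nat.rec v₀ (fun j x => next j x) j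
  have hu : ∀ j, u j ≠ 0 := by
    intro j
    cases j with
    | zero => exact hv₀
    | succ j => exact hnext j (u j)
  obtain ⟨v, hv, hR⟩ := exists_cyclic_family
    (fun k x y => OnCommonLine (A k *ᵥ x) (C k *ᵥ y)) u (k₁ + 1)
    (fun j _ => by
      have := hline j.val (u j)
      rw [Fin.ofNat_val_eq_self] at this
      exact this)
    (fun j hj => by
      have : k₁ + 1 + j = k₁ := by
        rw [add_assoc, add_comm 1 j, fin_add_one_eq_zero hj, add_zero]
      rw [this]
      change OnCommonLine _ (C k₁ *ᵥ v₀)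
      rw [hC]
      exact onCommonLine_zero_right _)
  refine ⟨v, fun k => ?_, hR⟩
  obtain ⟨j, hj⟩ := hv k
  exact hj ▸ hu j

/-- The cyclic family of pairs `(A k, C k)` has a one-dimensional invariant piece. -/
theorem exists_lines {n m : ℕ} [NeZero m]
    (A C : Fin m → Matrix (Fin (n + 1)) (Fin (n + 1)) ℂ) :
    ∃ v : Fin m → Fin (n + 1) → ℂ, (∀ k, v k ≠ 0) ∧
      ∀ k, OnCommonLine (A k *ᵥ v k) (C k *ᵥ v (k + 1)) := by
  by_cases hC : ∃ k, (C k).det = 0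
  · obtain ⟨k₁, h₁⟩ := hC
    exact exists_lines_of_det_eq_zero A C k₁ h₁
  by_cases hA : ∃ k, (A k).det = 0
  · obtain ⟨k₁, h₁⟩ := hA
    -- Reversing the cycle exchanges the roles of `A` and `C`.
    obtain ⟨v, hv, hR⟩ := exists_lines_of_det_eq_zero (fun k => C (-k - 1)) (fun k => A (-k - 1))
      (-k₁ - 1) (by simpa using h₁)
    refine ⟨fun k => v (-k), fun k => hv _, fun k => ?_⟩
    have := (hR (-k - 1)).symm
    have e1 : -(-k - 1) - 1 = k := by abel
    have e2 : -k - 1 + 1 = -k := by abel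
    have e3 : -k - 1 = -(k + 1) := by abel
    simp only [e1, e2] at this
    rwa [e3] at this
  push Not at hA hC
  -- With everything invertible, the lines are transported by `C⁻¹ A`; they close up after `m` steps
  -- when started from an eigenvector of the monodromy `S m`.
  let S : ℕ → Matrix (Fin (n + 1)) (Fin (n + 1)) ℂ := fun j =>
    Nat.rec 1 (fun j T => (C (Fin.ofNat m j))⁻¹ * A (Fin.ofNat m j) * T) j
  have hS : ∀ j, S (j + 1) = (C (Fin.ofNat m j))⁻¹ * A (Fin.ofNat m j) * S j := fun j => rfl
  have hSdet : ∀ j, (S j).det ≠ 0 := by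
    intro j
    induction j with
    | zero => simp [S]
    | succ j ih =>
      rw [hS, det_mul, det_mul, det_nonsing_inv, Ring.inverse_eq_inv']
      exact mul_ne_zero (mul_ne_zero (inv_ne_zero (hC _)) (hA _)) ih
  have hinj : ∀ M : Matrix (Fin (n + 1)) (Fin (n + 1)) ℂ, M.det ≠ 0 →
      ∀ x, x ≠ 0 → M *ᵥ x ≠ 0 := fun M hM x hx h => hx (eq_zero_of_mulVec_eq_zero hM h)
  obtain ⟨μ, hμ⟩ := Module.End.exists_eigenvalue (Matrix.toLin' (S m))
  obtain ⟨x, hx⟩ := hμ.exists_hasEigenvector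
  have hx0 := hx.2
  have hxm : S m *ᵥ x = μ • x := by simpa using hx.apply_eq_smul
  have hCS : ∀ j : ℕ, C (Fin.ofNat m j) *ᵥ (S (j + 1) *ᵥ x) =
      A (Fin.ofNat m j) *ᵥ (S j *ᵥ x) := by
    intro j
    have hu : IsUnit (C (Fin.ofNat m j)).det := isUnit_iff_ne_zero.2 (hC _)
    rw [hS, mulVec_mulVec, mulVec_mulVec, Matrix.mul_assoc, mul_nonsing_inv_cancel_left _ _ hu]
  obtain ⟨v, hv, hR⟩ := exists_cyclic_family
    (fun k x y => OnCommonLine (A k *ᵥ x) (C k *ᵥ y)) (fun j => S j *ᵥ x) 0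
    (fun j _ => by
      have := hCS j
      rw [Fin.ofNat_val_eq_self] at this
      rw [zero_add, this]
      exact ⟨A j *ᵥ (S j *ᵥ x), hinj _ (hA _) _ (hinj _ (hSdet _) _ hx0), 1, 1, by simp, by simp⟩)
    (fun j hj => by
      have := hCS j
      rw [Fin.ofNat_val_eq_self, hj, hxm, mulVec_smul] at this
      rw [zero_add, ← this]
      refine ⟨C j *ᵥ x, hinj _ (hC _) _ hx0, μ, 1, rfl, by simp [S]⟩)
  refine ⟨v, fun k => ?_, hR⟩
  obtain ⟨j, hj⟩ := hv k
  exact hj ▸ hinj _ (hSdet j) _ hx0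

/-- A nonzero vector is the first column of an invertible matrix. -/
theorem exists_det_ne_zero_col_zero {n : ℕ} (v : Fin (n + 1) → ℂ) (hv : v ≠ 0) :
    ∃ S : Matrix (Fin (n + 1)) (Fin (n + 1)) ℂ, S.det ≠ 0 ∧ ∀ i, S i 0 = v i := by
  obtain ⟨i, hi⟩ := Function.ne_iff.1 hv
  let e := Equiv.swap 0 i
  refine ⟨((1 : Matrix (Fin (n + 1)) (Fin (n + 1)) ℂ).updateCol 0 (v ∘ e)).submatrix e id,
    ?_, fun j => ?_⟩
  · rw [det_permute]
    refine mul_ne_zero ?_ ?_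
    · simp
    · rw [← cramer_apply, cramer_one]
      simpa [e] using hi
  · simp [e]

/-- The matrix `1 ⊕ M`. -/
def oneSum {n : ℕ} (M : Matrix (Fin n) (Fin n) ℂ) : Matrix (Fin (n + 1)) (Fin (n + 1)) ℂ :=
  Matrix.of fun i j =>
    Fin.cases (Fin.cases 1 (fun _ => 0) j) (fun i' => Fin.cases 0 (fun j' => M i' j') j) i

section oneSum
variable {n : ℕ} (M : Matrix (Fin n) (Fin n) ℂ)

@[simp] theorem oneSum_zero_zero : oneSum M 0 0 = 1 := rfl
@[simp] theorem oneSum_zero_succ (j : Fin n) : oneSum M 0 j.succ = 0 := rfl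
@[simp] theorem oneSum_succ_zero (i : Fin n) : oneSum M i.succ 0 = 0 := rfl
@[simp] theorem oneSum_succ_succ (i j : Fin n) : oneSum M i.succ j.succ = M i j := rfl

theorem det_oneSum : (oneSum M).det = M.det := by
  rw [det_succ_row_zero, Fin.sum_univ_succ]
  simp only [oneSum_zero_zero, oneSum_zero_succ, mul_zero, zero_mul, Finset.sum_const_zero,
    add_zero, Fin.val_zero, pow_zero, one_mul]
  congr 1

theorem blockTriangular_oneSum_mul_mul {P Q : Matrix (Fin n) (Fin n) ℂ}
    {T : Matrix (Fin (n + 1)) (Fin (n + 1)) ℂ} (hT : ∀ i : Fin n, T i.succ 0 = 0)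
    (h : (P * T.submatrix Fin.succ Fin.succ * Q).BlockTriangular id) :
    (oneSum P * T * oneSum Q).BlockTriangular id := by
  intro i j hij
  simp only [id] at hij
  refine Fin.cases (fun hij => absurd hij (by simp)) (fun i hij => ?_) i hij
  revert hij
  refine Fin.cases (fun _ => ?_) (fun j hij => ?_) j
  · simp [Matrix.mul_apply, Fin.sum_univ_succ, hT]
  · have := h (i := i) (j := j) (by simpa using hij)
    simpa [Matrix.mul_apply, Fin.sum_univ_succ] using this

end oneSum

/-- In bases beginning with `v` and `w`, the relation `A v = a w` says that the first column is `a`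
times the first unit vector. This is the deflation step of the Schur form. -/
theorem inv_mul_mul_succ_zero {n : ℕ} {R A Q : Matrix (Fin (n + 1)) (Fin (n + 1)) ℂ}
    {v w : Fin (n + 1) → ℂ} {a : ℂ} (hR : R.det ≠ 0) (hRw : ∀ i, R i 0 = w i)
    (hQv : ∀ i, Q i 0 = v i) (h : A *ᵥ v = a • w) (i : Fin n) :
    (R⁻¹ * A * Q) i.succ 0 = 0 := by
  have hv : Q *ᵥ Pi.single 0 1 = v := by ext i; simp [hQv]
  have hw : R *ᵥ Pi.single 0 1 = w := by ext i; simp [hRw]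
  have : (R⁻¹ * A * Q) *ᵥ Pi.single 0 1 = a • Pi.single 0 1 := by
    rw [← mulVec_mulVec, ← mulVec_mulVec, hv, h, ← hw, ← mulVec_smul, mulVec_mulVec,
      nonsing_inv_mul _ (isUnit_iff_ne_zero.2 hR), one_mulVec]
  have := congrFun this i.succ
  simpa using this

/-- Generalized periodic Schur form. -/
theorem exists_triangular {m : ℕ} [NeZero m] : ∀ {n : ℕ}
    (A C : Fin m → Matrix (Fin n) (Fin n) ℂ),
    ∃ P Q : Fin m → Matrix (Fin n) (Fin n) ℂ, (∀ k, (P k).det ≠ 0) ∧ (∀ k, (Q k).det ≠ 0) ∧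
      (∀ k, (P k * A k * Q k).BlockTriangular id) ∧
      ∀ k, (P k * C k * Q (k + 1)).BlockTriangular id
  | 0, _, _ => ⟨fun _ => 1, fun _ => 1, by simp, by simp, fun _ i => i.elim0, fun _ i => i.elim0⟩
  | n + 1, A, C => by
    obtain ⟨v, hv, hline⟩ := exists_lines A C
    choose w hw a b ha hb using hline
    choose Q₀ hQ₀ hQv using fun k => exists_det_ne_zero_col_zero (v k) (hv k)
    choose R₀ hR₀ hRw using fun k => exists_det_ne_zero_col_zero (w k) (hw k)
    obtain ⟨P, Q, hP, hQ, hA, hC⟩ := exists_triangular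
      (fun k => ((R₀ k)⁻¹ * A k * Q₀ k).submatrix Fin.succ Fin.succ)
      (fun k => ((R₀ k)⁻¹ * C k * Q₀ (k + 1)).submatrix Fin.succ Fin.succ)
    refine ⟨fun k => oneSum (P k) * (R₀ k)⁻¹, fun k => Q₀ k * oneSum (Q k), fun k => ?_,
      fun k => ?_, fun k => ?_, fun k => ?_⟩
    · rw [det_mul, det_oneSum, det_nonsing_inv, Ring.inverse_eq_inv']
      exact mul_ne_zero (hP k) (inv_ne_zero (hR₀ k))
    · rw [det_mul, det_oneSum]
      exact mul_ne_zero (hQ₀ k) (hQ k)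
    · have := blockTriangular_oneSum_mul_mul
        (inv_mul_mul_succ_zero (hR₀ k) (hRw k) (hQv k) (ha k)) (hA k)
      simpa only [Matrix.mul_assoc] using this
    · have := blockTriangular_oneSum_mul_mul
        (inv_mul_mul_succ_zero (hR₀ k) (hRw k) (hQv (k + 1)) (hb k)) (hC k)
      simpa only [Matrix.mul_assoc] using this

end PeriodicSylvester
end

/-! ### Determinant of the block pencil -/

noncomputable section
namespace PeriodicSylvester
open Matrix Polynomial

/-- The cyclic bidiagonal matrix with diagonal `d` and cyclic superdiagonal `u`. -/
def cyclicBidiagonal {R : Type*} [CommRing R] {m : ℕ} [NeZero m] (d u : Fin m → R) :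
    Matrix (Fin m) (Fin m) R :=
  Matrix.of fun k l => (if l = k then d k else 0) + (if l = k + 1 then u k else 0)

/-- Column `0` carries only `d 0` in the first row and the last `u` in the last row, and the two
minors are triangular. For `m = 0` the two rows coincide and the entries add up; this case occurs
for a folded cycle with `r = 1`. -/
theorem det_cyclicBidiagonal_succ {R : Type*} [CommRing R] {m : ℕ} (d u : Fin (m + 1) → R) :
    (cyclicBidiagonal d u).det = ∏ k, d k + (-1) ^ m * ∏ k, u k := by
  have hlast : ∀ i : Fin (m + 1), 0 = i + 1 ↔ i = Fin.last m := by
    intro i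
    rw [eq_comm, ← Fin.last_add_one, add_left_inj]
  rw [det_succ_column_zero]
  simp only [cyclicBidiagonal, of_apply, hlast, mul_add, add_mul, mul_ite, ite_mul, mul_zero,
    zero_mul, Finset.sum_add_distrib]
  rw [Finset.sum_ite_eq, Finset.sum_ite_eq']
  simp only [Finset.mem_univ, if_true, Fin.val_zero, pow_zero, one_mul, Fin.val_last]
  congr 1
  · rw [det_of_isUpperTriangular, Fin.prod_univ_succ]
    · congr 1
      refine Finset.prod_congr rfl fun i _ => ?_
      have : i.succ ≠ i.succ + 1 := by
        intro h
        have h' : (i.succ : Fin (m + 1)) + 0 = i.succ + 1 := by rw [add_zero]; exact h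
        have h1 := add_left_cancel h'
        have : NeZero m := ⟨by have := i.pos; omega⟩
        obtain ⟨m, rfl⟩ := Nat.exists_eq_succ_of_ne_zero (NeZero.ne m)
        simp at h1
      simp [this]
    · intro i j hij
      simp only [id] at hij
      have h1 : j ≠ i := ne_of_lt hij
      have h2 : j.succ ≠ i.succ + 1 := by
        intro h
        have h' := congrArg Fin.val h
        rcases Nat.lt_or_ge (i.succ.val + 1) (m + 1) with hlt | hge
        · rw [Fin.val_add_one_of_lt' hlt] at h'
          simp only [Fin.val_succ] at h'
          omega
        · have : i.succ = Fin.last m := Fin.ext (by simp only [Fin.val_succ, Fin.val_last] at *; omega)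
          rw [this, Fin.last_add_one] at h
          exact Fin.succ_ne_zero j h
      simp [h1, h2]
  · rw [mul_assoc, det_of_isLowerTriangular, Fin.prod_univ_castSucc, mul_comm (u _)]
    · congr 2
      refine Finset.prod_congr rfl fun i _ => ?_
      have : i.succ ≠ i.castSucc := Fin.castSucc_lt_succ.ne'
      simp [this]
    · intro i j hij
      have hij : i < j := hij
      have h1 : j.succ ≠ i.castSucc := (Fin.castSucc_lt_succ.trans (Fin.succ_lt_succ_iff.2 hij)).ne'
      have h2 : j ≠ i := ne_of_gt hij
      simp [h1, h2]

theorem det_cyclicBidiagonal_neg {R : Type*} [CommRing R] {m : ℕ} [NeZero m] (f g : Fin m → R) :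
    (cyclicBidiagonal f (fun k => -g k)).det = ∏ k, f k - ∏ k, g k := by
  obtain ⟨m, rfl⟩ := Nat.exists_eq_succ_of_ne_zero (NeZero.ne m)
  rw [det_cyclicBidiagonal_succ, Finset.prod_neg, Finset.card_univ, Fintype.card_fin, ← mul_assoc,
    ← pow_add, Odd.neg_one_pow ⟨m, by omega⟩]
  ring

theorem cyclicBidiagonal_mulVec {R : Type*} [CommRing R] {m : ℕ} [NeZero m] (d u x : Fin m → R)
    (k : Fin m) : (cyclicBidiagonal d u *ᵥ x) k = d k * x k + u k * x (k + 1) := by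
  simp [cyclicBidiagonal, mulVec, dotProduct, add_mul, Finset.sum_add_distrib]

/-- A cyclic family of pencils `(F k, G k)` as one block pencil. -/
def cyclicPencil {n m : ℕ} [NeZero m] (F G : Fin m → Matrix (Fin n) (Fin n) ℂ) :
    Matrix (Fin n × Fin m) (Fin n × Fin m) ℂ[X] :=
  Matrix.of fun p q => (if q.2 = p.2 then X * C (F p.2 p.1 q.1) else 0) +
    (if q.2 = p.2 + 1 then C (G p.2 p.1 q.1) else 0)

theorem blockDiagonal_mul_cyclicPencil_mul {n m : ℕ} [NeZero m]
    (P F G Q : Fin m → Matrix (Fin n) (Fin n) ℂ) :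
    blockDiagonal (fun k => (P k).map C) * cyclicPencil F G * blockDiagonal (fun k => (Q k).map C)
      = cyclicPencil (fun k => P k * F k * Q k) (fun k => P k * G k * Q (k + 1)) := by
  ext1 ⟨i, k⟩ ⟨j, l⟩
  simp only [Matrix.mul_apply, Fintype.sum_prod_type, blockDiagonal_apply, cyclicPencil, of_apply,
    map_apply, ite_mul, zero_mul, mul_ite, mul_zero, Finset.sum_ite_eq, Finset.sum_ite_eq',
    Finset.mem_univ, if_true]
  by_cases h1 : l = k
  · subst h1
    by_cases h2 : l = l + 1
    · rw [← h2]
      simp only [if_true, map_sum, map_mul, Finset.mul_sum, Finset.sum_mul,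
        ← Finset.sum_add_distrib]
      refine Finset.sum_congr rfl fun q _ => Finset.sum_congr rfl fun p _ => ?_
      ring
    · simp only [if_neg h2, if_true, map_sum, map_mul, Finset.mul_sum, Finset.sum_mul, add_zero]
      refine Finset.sum_congr rfl fun q _ => Finset.sum_congr rfl fun p _ => ?_
      ring
  · simp only [if_neg h1, zero_add]
    by_cases h2 : l = k + 1
    · subst h2
      simp only [if_true, map_sum, map_mul, Finset.sum_mul]
    · simp [if_neg h2]

theorem det_blockDiagonal_map_C {n m : ℕ} (P : Fin m → Matrix (Fin n) (Fin n) ℂ) :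
    (blockDiagonal (fun k => (P k).map (C : ℂ →+* ℂ[X]))).det = C (∏ k, (P k).det) := by
  rw [det_blockDiagonal, map_prod]
  exact Finset.prod_congr rfl fun k _ => (RingHom.map_det _ _).symm

/-- Grouping the indices by matrix position rather than by `k` makes the pencil block triangular,
with one scalar cyclic block for each diagonal position. -/
theorem det_cyclicPencil_of_blockTriangular {n m : ℕ} [NeZero m]
    {F G : Fin m → Matrix (Fin n) (Fin n) ℂ} (hF : ∀ k, (F k).BlockTriangular id)
    (hG : ∀ k, (G k).BlockTriangular id) :
    (cyclicPencil F G).det =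
      ∏ i, (cyclicBidiagonal (fun k => X * C (F k i i)) (fun k => C (G k i i))).det := by
  have h : (cyclicPencil F G).BlockTriangular Prod.fst := by
    intro p q hpq
    have h1 := hF p.2 hpq
    have h2 := hG p.2 hpq
    simp [cyclicPencil, h1, h2]
  rw [h.det_fintype]
  refine Finset.prod_congr rfl fun i _ => ?_
  let e : Fin m ≃ {a : Fin n × Fin m // a.1 = i} :=
    { toFun := fun k => ⟨(i, k), rfl⟩
      invFun := fun a => a.1.2
      left_inv := fun k => rfl
      right_inv := by rintro ⟨⟨_, k⟩, rfl⟩; rfl }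
  rw [← det_submatrix_equiv_self e]
  rfl

theorem det_cyclicPencil {n m : ℕ} [NeZero m] {P F G Q : Fin m → Matrix (Fin n) (Fin n) ℂ}
    (hP : ∀ k, (P k).det ≠ 0) (hQ : ∀ k, (Q k).det ≠ 0)
    (hF : ∀ k, (P k * F k * Q k).BlockTriangular id)
    (hG : ∀ k, (P k * G k * Q (k + 1)).BlockTriangular id) :
    ∃ κ : ℂ, κ ≠ 0 ∧ (cyclicPencil F G).det = C κ *
      ∏ i, (cyclicBidiagonal (fun k => X * C ((P k * F k * Q k) i i))
        (fun k => C ((P k * G k * Q (k + 1)) i i))).det := by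
  have h := congrArg det (blockDiagonal_mul_cyclicPencil_mul P F G Q)
  rw [det_mul, det_mul, det_blockDiagonal_map_C, det_blockDiagonal_map_C,
    det_cyclicPencil_of_blockTriangular hF hG] at h
  have hδ : (∏ k, (P k).det) * ∏ k, (Q k).det ≠ 0 :=
    mul_ne_zero (Finset.prod_ne_zero_iff.2 fun k _ => hP k)
      (Finset.prod_ne_zero_iff.2 fun k _ => hQ k)
  refine ⟨((∏ k, (P k).det) * ∏ k, (Q k).det)⁻¹, inv_ne_zero hδ, ?_⟩
  rw [← h, mul_right_comm, ← C_mul, ← mul_assoc, ← C_mul, inv_mul_cancel₀ hδ, C_1, one_mul]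

instance neZero_add_self {r : ℕ} [NeZero r] : NeZero (r + r) := ⟨by have := NeZero.ne r; omega⟩

section blockPencil
variable {n r : ℕ} (s : StarOp) (A B C D : Fin r → Matrix (Fin n) (Fin n) ℂ)

/-- The family `A_1, …, A_r, B_1^⋆, …, B_r^⋆`. -/
def starAppend : Fin (r + r) → Matrix (Fin n) (Fin n) ℂ := Fin.append A (fun k => s.app (B k))

theorem starAppend_castAdd (k : Fin r) : starAppend s A B (Fin.castAdd r k) = A k :=
  Fin.append_left _ _ _

theorem starAppend_natAdd (k : Fin r) : starAppend s A B (Fin.natAdd r k) = s.app (B k) :=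
  Fin.append_right _ _ _

/-- The sign `-1` at the last index and `1` elsewhere. -/
def cornerSign (m : ℕ) (k : Fin m) : ℂ := if k.val + 1 = m then -1 else 1

theorem prod_cornerSign (m : ℕ) [NeZero m] : ∏ k, cornerSign m k = -1 := by
  obtain ⟨m, rfl⟩ := Nat.exists_eq_succ_of_ne_zero (NeZero.ne m)
  rw [Fin.prod_univ_castSucc]
  have : ∀ i : Fin m, cornerSign (m + 1) i.castSucc = 1 := by
    intro i
    have := i.2
    simp [cornerSign]
    omega
  simp [this]
  simp [cornerSign]

theorem blockPencil_submatrix_prodComm [NeZero r] :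
    (blockPencil s A B C D).submatrix (Equiv.prodComm _ _) (Equiv.prodComm _ _) =
      cyclicPencil (starAppend s A B)
        (fun k => cornerSign (r + r) k • starAppend s C D k) := by
  have hr := NeZero.ne r
  ext1 ⟨i, k⟩ ⟨j, l⟩
  have hk := k.2
  have hl := l.2
  simp only [submatrix_apply, Equiv.prodComm_apply, Prod.swap_prod_mk, blockPencil, of_apply,
    cyclicPencil, starAppend, Matrix.smul_apply, smul_eq_mul]
  by_cases hlast : k.val + 1 = r + r
  · have hk1 : k + 1 = 0 := fin_add_one_eq_zero hlast
    have h0 : l = k + 1 ↔ l.val = 0 := by rw [hk1, Fin.ext_iff, Fin.val_zero]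
    have h1 : ¬ l.val = k.val + 1 := by omega
    simp only [h0, hlast, cornerSign, if_true, true_and]
    by_cases hlk : l = k
    · have h2 : ¬ k.val = 0 := by omega
      simp only [hlk, if_true, if_neg h2, add_zero]
    · have h3 : ¬ l.val = r + r := by omega
      simp only [hlk, if_false, if_neg h3, zero_add]
      split_ifs <;> simp
  · have h0 : l = k + 1 ↔ l.val = k.val + 1 := by
      rw [Fin.ext_iff, Fin.val_add_one_of_lt' (by omega)]
    simp only [h0, hlast, cornerSign, if_false, false_and]
    by_cases hlk : l = k
    · simp [hlk]
    · simp [hlk]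

theorem det_blockPencil [NeZero r] {P Q : Fin (r + r) → Matrix (Fin n) (Fin n) ℂ}
    (hP : ∀ k, (P k).det ≠ 0) (hQ : ∀ k, (Q k).det ≠ 0)
    (hF : ∀ k, (P k * starAppend s A B k * Q k).BlockTriangular id)
    (hG : ∀ k, (P k * starAppend s C D k * Q (k + 1)).BlockTriangular id) :
    ∃ κ : ℂ, κ ≠ 0 ∧ (blockPencil s A B C D).det = Polynomial.C κ *
      ∏ i, (Polynomial.C (∏ k, (P k * starAppend s A B k * Q k) i i) * X ^ (2 * r) +
        Polynomial.C (∏ k, (P k * starAppend s C D k * Q (k + 1)) i i)) := by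
  have e : ∀ k, P k * (cornerSign (r + r) k • starAppend s C D k) * Q (k + 1) =
      cornerSign (r + r) k • (P k * starAppend s C D k * Q (k + 1)) := fun k => by
    rw [Matrix.mul_smul, Matrix.smul_mul]
  obtain ⟨κ, hκ, h⟩ := det_cyclicPencil (G := fun k => cornerSign (r + r) k • starAppend s C D k)
    hP hQ hF (fun k => by
      rw [e]
      intro i j hij
      rw [Matrix.smul_apply, hG k hij, smul_zero])
  refine ⟨κ, hκ, ?_⟩
  rw [← det_submatrix_equiv_self (Equiv.prodComm _ _), blockPencil_submatrix_prodComm, h]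
  congr 1
  refine Finset.prod_congr rfl fun i _ => ?_
  have hneg : ∀ k, Polynomial.C ((P k * (cornerSign (r + r) k • starAppend s C D k) *
      Q (k + 1)) i i) = -(-Polynomial.C (cornerSign (r + r) k) *
        Polynomial.C ((P k * starAppend s C D k * Q (k + 1)) i i)) := fun k => by
    rw [e, Matrix.smul_apply, smul_eq_mul, C_mul]
    ring
  simp only [hneg]
  -- The even cycle length `2r` absorbs the signs from `-g`; the single corner sign turns the
  -- difference of products into a sum.
  rw [det_cyclicBidiagonal_neg, Finset.prod_mul_distrib, Finset.prod_mul_distrib,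
    Finset.prod_neg, ← map_prod, ← map_prod, ← map_prod, prod_cornerSign]
  simp only [Finset.card_univ, Fintype.card_fin, Finset.prod_const, map_neg, map_one]
  rw [Even.neg_one_pow ⟨r, rfl⟩, two_mul r]
  ring

end blockPencil

end PeriodicSylvester
end

/-! ### The star operation, the half turn and the doubled system -/

noncomputable section
namespace PeriodicSylvester
open Matrix

namespace StarOp

/-- The action of `⋆` on scalars. -/
def hom : StarOp → ℂ →+* ℂ
  | .transpose => RingHom.id ℂ
  | .conjTranspose => starRingEnd ℂ

variable (s : StarOp) {n : ℕ}

@[simp] theorem hom_hom (z : ℂ) : s.hom (s.hom z) = z := by cases s <;> simp [hom]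

theorem app_apply (M : Matrix (Fin n) (Fin n) ℂ) (i j : Fin n) : s.app M i j = s.hom (M j i) := by
  cases s <;> rfl

@[simp] theorem app_app (M : Matrix (Fin n) (Fin n) ℂ) : s.app (s.app M) = M := by
  ext; simp [app_apply]

theorem app_mul (M N : Matrix (Fin n) (Fin n) ℂ) : s.app (M * N) = s.app N * s.app M := by
  ext; simp [app_apply, Matrix.mul_apply, mul_comm]

theorem app_sub (M N : Matrix (Fin n) (Fin n) ℂ) : s.app (M - N) = s.app M - s.app N := by
  ext; simp [app_apply]

theorem app_add (M N : Matrix (Fin n) (Fin n) ℂ) : s.app (M + N) = s.app M + s.app N := by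
  ext; simp [app_apply]

theorem app_real_smul (t : ℝ) (M : Matrix (Fin n) (Fin n) ℂ) : s.app (t • M) = t • s.app M := by
  ext; cases s <;> simp [app_apply, hom]

@[simp] theorem app_one : s.app (1 : Matrix (Fin n) (Fin n) ℂ) = 1 := by
  cases s <;> simp [app]

@[simp] theorem app_zero : s.app (0 : Matrix (Fin n) (Fin n) ℂ) = 0 := by
  ext; simp [app_apply]

end StarOp

section halfTurn
variable {r : ℕ} [NeZero r]

/-- The index shift `k ↦ k + r` modulo `2 r`. -/
def halfTurn (k : Fin (r + r)) : Fin (r + r) := k + ⟨r, by have := NeZero.pos r; omega⟩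

@[simp] theorem halfTurn_castAdd (k : Fin r) : halfTurn (Fin.castAdd r k) = Fin.natAdd r k := by
  apply Fin.ext
  have := k.2
  simp only [halfTurn, Fin.val_add, Fin.val_castAdd, Fin.val_natAdd]
  rw [Nat.mod_eq_of_lt (by omega), add_comm]

@[simp] theorem halfTurn_natAdd (k : Fin r) : halfTurn (Fin.natAdd r k) = Fin.castAdd r k := by
  apply Fin.ext
  have := k.2
  simp only [halfTurn, Fin.val_add, Fin.val_castAdd, Fin.val_natAdd]
  rw [add_right_comm, Nat.add_mod_left, Nat.mod_eq_of_lt (by omega)]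

@[simp] theorem halfTurn_halfTurn (k : Fin (r + r)) : halfTurn (halfTurn k) = k := by
  refine Fin.addCases (fun k => ?_) (fun k => ?_) k <;> simp [-Fin.natAdd_eq_addNat]

theorem halfTurn_add_one (k : Fin (r + r)) : halfTurn (k + 1) = halfTurn k + 1 :=
  add_right_comm _ _ _

theorem forall_fin_add_self {p : Fin (r + r) → Prop} (h₁ : ∀ k : Fin r, p (Fin.castAdd r k))
    (h₂ : ∀ k, p k → p (halfTurn k)) (k : Fin (r + r)) : p k := by
  refine Fin.addCases h₁ (fun k => ?_) k
  rw [← halfTurn_castAdd]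
  exact h₂ _ (h₁ k)

theorem castAdd_add_one_of_lt {k : Fin r} (h : k.val + 1 < r) :
    Fin.castAdd r k + 1 = Fin.castAdd r ⟨k.val + 1, h⟩ := by
  apply Fin.ext
  rw [Fin.val_add_one_of_lt' (by rw [Fin.val_castAdd]; omega)]
  rfl

theorem castAdd_add_one_of_not_lt {k : Fin r} (h : ¬ k.val + 1 < r) :
    Fin.castAdd r k + 1 = halfTurn (Fin.castAdd r ⟨0, k.pos⟩) := by
  have := k.2
  apply Fin.ext
  rw [Fin.val_add_one_of_lt' (by rw [Fin.val_castAdd]; omega), halfTurn_castAdd,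
    Fin.val_castAdd, Fin.val_natAdd]
  change k.val + 1 = r + 0
  omega

/-- A half-turn invariant family lives on the cycle of length `r`, so the successor modulo `2r` may
be replaced by the one modulo `r`. -/
theorem apply_castAdd_add_one {α : Type*} {y : Fin (r + r) → α}
    (hy : ∀ k, y (halfTurn k) = y k) (k : Fin r) :
    y (Fin.castAdd r k + 1) = y (Fin.castAdd r (k + 1)) := by
  by_cases h : k.val + 1 < r
  · rw [castAdd_add_one_of_lt h]
    congr 2
    apply Fin.ext
    rw [Fin.val_add_one_of_lt' h]
  · rw [castAdd_add_one_of_not_lt h, hy]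
    have : k + 1 = 0 := fin_add_one_eq_zero (by omega)
    rw [this]
    rfl

theorem prod_halfTurn (f : Fin (r + r) → ℂ) : ∏ k, f (halfTurn k) = ∏ k, f k :=
  Equiv.prod_comp (⟨halfTurn, halfTurn, halfTurn_halfTurn, halfTurn_halfTurn⟩ : Equiv.Perm _) f

end halfTurn

section symmetricSystem
variable {n r : ℕ} [NeZero r] (s : StarOp)

/-- Families with `Y_{k+r} = Y_k^⋆`. -/
def IsStarSymmetric (Y : Fin (r + r) → Matrix (Fin n) (Fin n) ℂ) : Prop :=
  ∀ k, Y (halfTurn k) = s.app (Y k)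

/-- The doubled cyclic operator `Y ↦ F_k Y_k F_{k+r}^⋆ - G_k Y_{k+1} G_{k+r}^⋆`. -/
def doubledOp (F G Y : Fin (r + r) → Matrix (Fin n) (Fin n) ℂ) (k : Fin (r + r)) :
    Matrix (Fin n) (Fin n) ℂ :=
  F k * Y k * s.app (F (halfTurn k)) - G k * Y (k + 1) * s.app (G (halfTurn k))

/-- The congruence `Y ↦ Q_k Y_k Q_{k+r}^⋆`. -/
def starCongr (Q Y : Fin (r + r) → Matrix (Fin n) (Fin n) ℂ) (k : Fin (r + r)) :
    Matrix (Fin n) (Fin n) ℂ :=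
  Q k * Y k * s.app (Q (halfTurn k))

variable {s}

theorem isStarSymmetric_starAppend (X : Fin r → Matrix (Fin n) (Fin n) ℂ) :
    IsStarSymmetric s (starAppend s X X) := by
  intro k
  refine Fin.addCases (fun k => ?_) (fun k => ?_) k <;> simp [starAppend, -Fin.natAdd_eq_addNat]

theorem IsStarSymmetric.eq_starAppend {Y : Fin (r + r) → Matrix (Fin n) (Fin n) ℂ}
    (hY : IsStarSymmetric s Y) :
    Y = starAppend s (fun k => Y (Fin.castAdd r k)) (fun k => Y (Fin.castAdd r k)) := by
  funext k
  refine Fin.addCases (fun k => ?_) (fun k => ?_) k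
  · simp [starAppend]
  · rw [← halfTurn_castAdd, hY]
    simp [starAppend, -Fin.natAdd_eq_addNat]

theorem IsStarSymmetric.doubledOp {F G Y : Fin (r + r) → Matrix (Fin n) (Fin n) ℂ}
    (hY : IsStarSymmetric s Y) : IsStarSymmetric s (doubledOp s F G Y) := by
  intro k
  have h1 := hY (k + 1)
  rw [halfTurn_add_one] at h1
  simp only [PeriodicSylvester.doubledOp, StarOp.app_sub, StarOp.app_mul, StarOp.app_app, hY k, h1,
    halfTurn_halfTurn, Matrix.mul_assoc]

theorem IsStarSymmetric.starCongr {Q Y : Fin (r + r) → Matrix (Fin n) (Fin n) ℂ}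
    (hY : IsStarSymmetric s Y) : IsStarSymmetric s (starCongr s Q Y) := by
  intro k
  simp only [PeriodicSylvester.starCongr, StarOp.app_mul, StarOp.app_app, hY k,
    halfTurn_halfTurn, Matrix.mul_assoc]

theorem starCongr_starCongr (P Q Y : Fin (r + r) → Matrix (Fin n) (Fin n) ℂ) :
    starCongr s P (starCongr s Q Y) = starCongr s (fun k => P k * Q k) Y := by
  funext k
  simp only [starCongr, StarOp.app_mul, Matrix.mul_assoc]

theorem starCongr_one (Y : Fin (r + r) → Matrix (Fin n) (Fin n) ℂ) :
    starCongr s (fun _ => 1) Y = Y := by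
  funext k
  simp [starCongr]

theorem starCongr_zero (Q : Fin (r + r) → Matrix (Fin n) (Fin n) ℂ) :
    starCongr s Q (fun _ => 0) = fun _ => 0 := by
  funext k
  simp [starCongr]

theorem starCongr_mul_inv {Q : Fin (r + r) → Matrix (Fin n) (Fin n) ℂ}
    (hQ : ∀ k, (Q k).det ≠ 0) (Y : Fin (r + r) → Matrix (Fin n) (Fin n) ℂ) :
    starCongr s Q (starCongr s (fun k => (Q k)⁻¹) Y) = Y := by
  rw [starCongr_starCongr]
  simp only [fun k => mul_nonsing_inv _ (isUnit_iff_ne_zero.2 (hQ k)), starCongr_one]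

theorem doubledOp_congr (P Q F G Y : Fin (r + r) → Matrix (Fin n) (Fin n) ℂ) :
    doubledOp s (fun k => P k * F k * Q k) (fun k => P k * G k * Q (k + 1)) Y =
      starCongr s P (doubledOp s F G (starCongr s Q Y)) := by
  funext k
  simp only [doubledOp, starCongr, StarOp.app_mul, Matrix.mul_assoc, halfTurn_add_one,
    Matrix.mul_sub, Matrix.sub_mul]

/-- The first `r` doubled equations are the original ones, the star in the last of them coming from
`Y_{r+1} = X_1^⋆`. The other `r` are their images under `⋆`. -/
theorem isSolution_iff {A B C D E X : Fin r → Matrix (Fin n) (Fin n) ℂ} :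
    IsSolution s A B C D E X ↔
      doubledOp s (starAppend s A B) (starAppend s C D) (starAppend s X X) =
        starAppend s E E := by
  have key : ∀ k : Fin r, doubledOp s (starAppend s A B) (starAppend s C D) (starAppend s X X)
      (Fin.castAdd r k) = A k * X k * B k
      - C k * (if h : k.val + 1 < r then X ⟨k.val + 1, h⟩ else s.app (X ⟨0, k.pos⟩)) * D k := by
    intro k
    simp only [doubledOp, halfTurn_castAdd, starAppend_castAdd, starAppend_natAdd, StarOp.app_app]
    split_ifs with h
    · rw [castAdd_add_one_of_lt h, starAppend_castAdd]
    · rw [castAdd_add_one_of_not_lt h, isStarSymmetric_starAppend, starAppend_castAdd]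
  constructor
  · intro h
    refine funext (forall_fin_add_self (fun k => ?_) (fun k hk => ?_))
    · rw [key, h k, starAppend_castAdd]
    · rw [(isStarSymmetric_starAppend X).doubledOp, hk, isStarSymmetric_starAppend]
  · intro h k
    rw [← key, h, starAppend_castAdd]

/-- The left-hand side of the periodic system as a real-linear map. -/
def systemMap (s : StarOp) (A B C D : Fin r → Matrix (Fin n) (Fin n) ℂ) :
    (Fin r → Matrix (Fin n) (Fin n) ℂ) →ₗ[ℝ] (Fin r → Matrix (Fin n) (Fin n) ℂ) where
  toFun X k := A k * X k * B k
      - C k * (if h : k.val + 1 < r then X ⟨k.val + 1, h⟩ else s.app (X ⟨0, k.pos⟩)) * D k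
  map_add' X Y := by
    funext k
    by_cases h : k.val + 1 < r
    · simp only [h, dif_pos, Pi.add_apply, Matrix.mul_add, Matrix.add_mul]
      abel
    · simp only [h, Pi.add_apply, Matrix.mul_add, Matrix.add_mul, dif_neg, not_false_eq_true,
        StarOp.app_add]
      abel
  map_smul' t X := by
    funext k
    by_cases h : k.val + 1 < r
    · simp [h, smul_sub]
    · simp [h, smul_sub, StarOp.app_real_smul]

theorem isSolution_iff_systemMap {A B C D E X : Fin r → Matrix (Fin n) (Fin n) ℂ} :
    IsSolution s A B C D E X ↔ systemMap s A B C D X = E :=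
  funext_iff.symm

/-- An injective endomorphism of a finite-dimensional space is bijective. The scalars are real
because the conjugate transpose is not complex-linear. -/
theorem isNonsingularSystem_of_injective {A B C D : Fin r → Matrix (Fin n) (Fin n) ℂ}
    (h : ∀ Y, IsStarSymmetric s Y →
      doubledOp s (starAppend s A B) (starAppend s C D) Y = (fun _ => 0) → Y = fun _ => 0) :
    IsNonsingularSystem s A B C D := by
  have hinj : Function.Injective (systemMap s A B C D) := by
    rw [← LinearMap.ker_eq_bot, LinearMap.ker_eq_bot']
    intro X hX
    rw [← isSolution_iff_systemMap, isSolution_iff] at hX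
    have h0 : starAppend s (0 : Fin r → Matrix (Fin n) (Fin n) ℂ) 0 = fun _ => 0 := by
      funext k
      refine Fin.addCases (fun k => ?_) (fun k => ?_) k <;> simp [starAppend, -Fin.natAdd_eq_addNat]
    have := h _ (isStarSymmetric_starAppend X) (hX.trans h0)
    funext k
    simpa [starAppend] using congrFun this (Fin.castAdd r k)
  have hbij : Function.Bijective (systemMap s A B C D) :=
    ⟨hinj, LinearMap.injective_iff_surjective.1 hinj⟩
  intro E
  simpa only [isSolution_iff_systemMap] using hbij.existsUnique E

theorem IsNonsingularSystem.surjective {A B C D : Fin r → Matrix (Fin n) (Fin n) ℂ}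
    (h : IsNonsingularSystem s A B C D) {E : Fin (r + r) → Matrix (Fin n) (Fin n) ℂ}
    (hE : IsStarSymmetric s E) :
    ∃ Y, IsStarSymmetric s Y ∧ doubledOp s (starAppend s A B) (starAppend s C D) Y = E := by
  obtain ⟨X, hX, -⟩ := h (fun k => E (Fin.castAdd r k))
  refine ⟨starAppend s X X, isStarSymmetric_starAppend X, ?_⟩
  rw [hE.eq_starAppend]
  exact isSolution_iff.1 hX

theorem doubledOp_injective_of_congr {P Q F G : Fin (r + r) → Matrix (Fin n) (Fin n) ℂ}
    (hQ : ∀ k, (Q k).det ≠ 0)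
    (h : ∀ Y, IsStarSymmetric s Y → doubledOp s (fun k => P k * F k * Q k)
      (fun k => P k * G k * Q (k + 1)) Y = (fun _ => 0) → Y = fun _ => 0)
    {Y : Fin (r + r) → Matrix (Fin n) (Fin n) ℂ} (hY : IsStarSymmetric s Y)
    (h0 : doubledOp s F G Y = fun _ => 0) : Y = fun _ => 0 := by
  have := h (starCongr s (fun k => (Q k)⁻¹) Y) hY.starCongr (by
    rw [doubledOp_congr, starCongr_mul_inv hQ, h0, starCongr_zero])
  rw [← starCongr_mul_inv (s := s) hQ Y, this, starCongr_zero]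

theorem doubledOp_surjective_congr {P Q F G : Fin (r + r) → Matrix (Fin n) (Fin n) ℂ}
    (hP : ∀ k, (P k).det ≠ 0) (hQ : ∀ k, (Q k).det ≠ 0)
    (h : ∀ E, IsStarSymmetric s E → ∃ Y, IsStarSymmetric s Y ∧ doubledOp s F G Y = E)
    {E : Fin (r + r) → Matrix (Fin n) (Fin n) ℂ} (hE : IsStarSymmetric s E) :
    ∃ Y, IsStarSymmetric s Y ∧ doubledOp s (fun k => P k * F k * Q k)
      (fun k => P k * G k * Q (k + 1)) Y = E := by
  obtain ⟨Y, hY, hYE⟩ := h _ (hE.starCongr (Q := fun k => (P k)⁻¹))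
  refine ⟨starCongr s (fun k => (Q k)⁻¹) Y, hY.starCongr, ?_⟩
  rw [doubledOp_congr, starCongr_mul_inv hQ, hYE, starCongr_mul_inv hP]

end symmetricSystem

/-! ### Reduction of the triangular system to scalar cycles -/

section triangular
variable {n r : ℕ} [NeZero r] {s : StarOp}

/-- Entry `(i, j)` of the product involves only `Y p q` with `p ≥ i` and `q ≥ j`; all of these but
`Y i j` vanish by `hY`. -/
theorem mul_mul_app_apply_of_blockTriangular {T T' Y : Matrix (Fin n) (Fin n) ℂ}
    (hT : T.BlockTriangular id) (hT' : T'.BlockTriangular id) {x : Fin n × Fin n}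
    (hY : ∀ z, x < z → Y z.1 z.2 = 0) :
    (T * Y * s.app T') x.1 x.2 = T x.1 x.1 * s.hom (T' x.2 x.2) * Y x.1 x.2 := by
  simp only [Matrix.mul_apply, StarOp.app_apply, Finset.sum_mul]
  rw [Finset.sum_eq_single x.2, Finset.sum_eq_single x.1]
  · ring
  · intro p _ hp
    rcases lt_or_gt_of_ne hp with h | h
    · rw [hT h, zero_mul, zero_mul]
    · rw [hY (p, x.2) (Prod.mk_lt_mk_iff_left.2 h), mul_zero, zero_mul]
  · simp
  · intro q _ hq
    refine Finset.sum_eq_zero fun p _ => ?_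
    rcases lt_or_gt_of_ne hq with h | h
    · rw [hT' h, map_zero, mul_zero]
    · rcases lt_or_ge p x.1 with h' | h'
      · rw [hT h', zero_mul, zero_mul]
      · rw [hY (p, q) (Prod.lt_iff.2 (Or.inr ⟨h', h⟩)), mul_zero, zero_mul]
  · simp

theorem doubledOp_apply_of_blockTriangular {F G Y : Fin (r + r) → Matrix (Fin n) (Fin n) ℂ}
    (hF : ∀ k, (F k).BlockTriangular id) (hG : ∀ k, (G k).BlockTriangular id)
    {x : Fin n × Fin n} (hY : ∀ z, x < z → ∀ k, Y k z.1 z.2 = 0) (k : Fin (r + r)) :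
    doubledOp s F G Y k x.1 x.2 =
      F k x.1 x.1 * s.hom (F (halfTurn k) x.2 x.2) * Y k x.1 x.2 -
        G k x.1 x.1 * s.hom (G (halfTurn k) x.2 x.2) * Y (k + 1) x.1 x.2 := by
  rw [doubledOp, Matrix.sub_apply,
    mul_mul_app_apply_of_blockTriangular (hF _) (hF _) fun z hz => hY z hz _,
    mul_mul_app_apply_of_blockTriangular (hG _) (hG _) fun z hz => hY z hz _]

/-- The condition on the pairs `(a i, c i)` under which the scalar cyclic system at position
`(i, j)` is nonsingular. -/
def IsSeparated (s : StarOp) {ι : Type*} (a c : ι → ℂ) (i j : ι) : Prop :=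
  (s = .transpose ∧ i = j → a i ≠ c i) ∧
    (¬ (s = .transpose ∧ i = j) → a i * s.hom (a j) ≠ c i * s.hom (c j))

theorem prod_mul_hom_halfTurn (f g : Fin (r + r) → ℂ) :
    ∏ k, f k * s.hom (g (halfTurn k)) = (∏ k, f k) * s.hom (∏ k, g k) := by
  rw [Finset.prod_mul_distrib, map_prod, prod_halfTurn fun k => s.hom (g k)]

theorem prod_castAdd_mul_halfTurn (f : Fin (r + r) → ℂ) :
    ∏ k : Fin r, f (Fin.castAdd r k) * f (halfTurn (Fin.castAdd r k)) = ∏ k, f k := by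
  simp only [halfTurn_castAdd, Finset.prod_mul_distrib, Fin.prod_univ_add]

theorem scalar_cyclic_injective {m : ℕ} [NeZero m] {f g y : Fin m → ℂ}
    (h : ∏ k, f k ≠ ∏ k, g k) (hy : ∀ k, f k * y k - g k * y (k + 1) = 0) : y = 0 := by
  refine eq_zero_of_mulVec_eq_zero (M := cyclicBidiagonal f fun k => -g k) ?_ ?_
  · rw [det_cyclicBidiagonal_neg]
    exact sub_ne_zero.2 h
  · funext k
    rw [cyclicBidiagonal_mulVec, neg_mul, ← sub_eq_add_neg, hy, Pi.zero_apply]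

theorem prod_ne_prod_of_scalar_cyclic_surjective {m : ℕ} [NeZero m] {f g : Fin m → ℂ}
    (h : ∀ e : Fin m → ℂ, ∃ y : Fin m → ℂ, ∀ k, f k * y k - g k * y (k + 1) = e k) :
    ∏ k, f k ≠ ∏ k, g k := by
  have hs : Function.Surjective (cyclicBidiagonal f fun k => -g k).mulVec := by
    intro e
    obtain ⟨y, hy⟩ := h e
    refine ⟨y, funext fun k => ?_⟩
    rw [cyclicBidiagonal_mulVec, neg_mul, ← sub_eq_add_neg, hy]
  have := (isUnit_iff_isUnit_det _).1 (mulVec_surjective_iff_isUnit.1 hs)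
  rw [det_cyclicBidiagonal_neg] at this
  exact sub_ne_zero.1 this.ne_zero

/-- On the diagonal with `⋆ = ⊤`, symmetry makes `y` invariant under the half turn, and the folded
cycle of length `r` has coefficient products `a_i` and `c_i` instead of their squares. Otherwise the
full cycle is nonsingular and symmetry is not needed. -/
theorem IsSeparated.eq_zero {F G : Fin (r + r) → Fin n → ℂ} {i j : Fin n}
    (h : IsSeparated s (fun i => ∏ k, F k i) (fun i => ∏ k, G k i) i j)
    {y : Fin (r + r) → ℂ} (hsymm : i = j → ∀ k, y (halfTurn k) = s.hom (y k))
    (hy : ∀ k, F k i * s.hom (F (halfTurn k) j) * y k -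
      G k i * s.hom (G (halfTurn k) j) * y (k + 1) = 0) : y = 0 := by
  by_cases hs : s = .transpose ∧ i = j
  · have hne := h.1 hs
    obtain ⟨rfl, rfl⟩ := hs
    replace hsymm : ∀ k, y (halfTurn k) = y k := hsymm rfl
    have h0 : (fun k : Fin r => y (Fin.castAdd r k)) = 0 := by
      refine scalar_cyclic_injective
        (f := fun k => F (Fin.castAdd r k) i * F (halfTurn (Fin.castAdd r k)) i)
        (g := fun k => G (Fin.castAdd r k) i * G (halfTurn (Fin.castAdd r k)) i) ?_ fun k => ?_
      · rw [prod_castAdd_mul_halfTurn fun k => F k i, prod_castAdd_mul_halfTurn fun k => G k i]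
        exact hne
      · have := hy (Fin.castAdd r k)
        rwa [apply_castAdd_add_one hsymm] at this
    refine funext (forall_fin_add_self (fun k => congrFun h0 k) (fun k hk => ?_))
    rw [hsymm, hk]
    rfl
  · have hne := h.2 hs
    refine scalar_cyclic_injective ?_ hy
    rwa [prod_mul_hom_halfTurn (fun k => F k i) fun k => F k j,
      prod_mul_hom_halfTurn (fun k => G k i) fun k => G k j]

theorem isSeparated_of_surjective {F G : Fin (r + r) → Fin n → ℂ} {i j : Fin n}
    (h : ∀ e : Fin (r + r) → ℂ, (i = j → ∀ k, e (halfTurn k) = s.hom (e k)) →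
      ∃ y : Fin (r + r) → ℂ, (i = j → ∀ k, y (halfTurn k) = s.hom (y k)) ∧
        ∀ k, F k i * s.hom (F (halfTurn k) j) * y k -
          G k i * s.hom (G (halfTurn k) j) * y (k + 1) = e k) :
    IsSeparated s (fun i => ∏ k, F k i) (fun i => ∏ k, G k i) i j := by
  constructor
  · rintro ⟨rfl, rfl⟩
    change ∏ k, F k i ≠ ∏ k, G k i
    rw [← prod_castAdd_mul_halfTurn fun k => F k i, ← prod_castAdd_mul_halfTurn fun k => G k i]
    refine prod_ne_prod_of_scalar_cyclic_surjective fun e => ?_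
    obtain ⟨y, hy, hye⟩ := h (Fin.append e e) (fun _ k => by
      change _ = Fin.append e e k
      refine Fin.addCases (fun k => ?_) (fun k => ?_) k <;> simp [-Fin.natAdd_eq_addNat])
    replace hy : ∀ k, y (halfTurn k) = y k := hy rfl
    refine ⟨fun k => y (Fin.castAdd r k), fun k => ?_⟩
    have := hye (Fin.castAdd r k)
    rw [apply_castAdd_add_one hy, Fin.append_left] at this
    exact this
  · intro hs
    rw [← prod_mul_hom_halfTurn (fun k => F k i) fun k => F k j,
      ← prod_mul_hom_halfTurn (fun k => G k i) fun k => G k j]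
    refine prod_ne_prod_of_scalar_cyclic_surjective fun e => ?_
    by_cases hij : i = j
    · have hs' : s = .conjTranspose := by
        cases s
        · exact absurd ⟨rfl, hij⟩ hs
        · rfl
      subst hs'
      -- Only symmetric right-hand sides are available on the diagonal. An arbitrary `e` is a
      -- symmetric family plus `i` times another, and the scalar cycle is complex-linear.
      obtain ⟨y, -, hy⟩ := h (fun k => (e k + starRingEnd ℂ (e (halfTurn k))) / 2) (fun _ k => by
        simp [StarOp.hom, add_comm, map_ofNat])
      obtain ⟨z, -, hz⟩ := h
        (fun k => (e k - starRingEnd ℂ (e (halfTurn k))) / (2 * Complex.I)) (fun _ k => by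
          simp only [StarOp.hom, map_div₀, map_sub, map_mul, map_ofNat, Complex.conj_I,
            Complex.conj_conj, halfTurn_halfTurn]
          field_simp
          ring)
      refine ⟨fun k => y k + Complex.I * z k, fun k => ?_⟩
      have hI : Complex.I * ((e k - starRingEnd ℂ (e (halfTurn k))) / (2 * Complex.I)) =
          (e k - starRingEnd ℂ (e (halfTurn k))) / 2 := by
        field_simp [Complex.I_ne_zero]
      linear_combination hy k + Complex.I * hz k + hI
    · obtain ⟨y, -, hy⟩ := h e (fun h => absurd h hij)
      exact ⟨y, hy⟩

/-- Back substitution, descending in the product order. An upper set `U` allows both uses: all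
positions, and the positions strictly above a given one. -/
theorem eq_zero_of_isSeparated {F G Y : Fin (r + r) → Matrix (Fin n) (Fin n) ℂ}
    (hF : ∀ k, (F k).BlockTriangular id) (hG : ∀ k, (G k).BlockTriangular id)
    (hY : IsStarSymmetric s Y) {U : Set (Fin n × Fin n)} (hU : IsUpperSet U)
    (hsep : ∀ x ∈ U, IsSeparated s (fun i => ∏ k, F k i i) (fun i => ∏ k, G k i i) x.1 x.2)
    (h0 : ∀ x ∈ U, ∀ k, doubledOp s F G Y k x.1 x.2 = 0) :
    ∀ x ∈ U, ∀ k, Y k x.1 x.2 = 0 := by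
  intro x
  induction x using WellFoundedGT.induction with
  | ind x ih =>
    intro hx
    have habove : ∀ z, x < z → ∀ k, Y k z.1 z.2 = 0 := fun z hz => ih z hz (hU hz.le hx)
    have := (hsep x hx).eq_zero (F := fun k i => F k i i) (G := fun k i => G k i i)
      (y := fun k => Y k x.1 x.2)
      (fun hij k => by rw [hY k, StarOp.app_apply, hij])
      (fun k => by rw [← doubledOp_apply_of_blockTriangular hF hG habove, h0 x hx k])
    exact fun k => congrFun this k

theorem isSeparated_of_doubledOp_surjective {F G : Fin (r + r) → Matrix (Fin n) (Fin n) ℂ}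
    (hF : ∀ k, (F k).BlockTriangular id) (hG : ∀ k, (G k).BlockTriangular id)
    (h : ∀ E, IsStarSymmetric s E → ∃ Y, IsStarSymmetric s Y ∧ doubledOp s F G Y = E)
    (x : Fin n × Fin n) :
    IsSeparated s (fun i => ∏ k, F k i i) (fun i => ∏ k, G k i i) x.1 x.2 := by
  induction x using WellFoundedGT.induction with
  | ind x ih =>
    obtain ⟨i, j⟩ := x
    refine isSeparated_of_surjective (F := fun k i => F k i i) (G := fun k i => G k i i)
      fun e he => ?_
    -- The star-symmetric right-hand side with `e` at `(i, j)`, which forces its mirror image at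
    -- `(j, i)`. Neither position is strictly above `(i, j)`, so the induction hypothesis makes `Y`
    -- vanish there and the scalar equation at `(i, j)` decouples.
    let E : Fin (r + r) → Matrix (Fin n) (Fin n) ℂ := fun k => Matrix.of fun p q =>
      if p = i ∧ q = j then e k else if p = j ∧ q = i then s.hom (e (halfTurn k)) else 0
    have hE : IsStarSymmetric s E := by
      intro k
      ext p q
      simp only [E, of_apply, StarOp.app_apply, halfTurn_halfTurn]
      by_cases h1 : p = i ∧ q = j
      · by_cases h2 : q = i ∧ p = j
        · have hij : i = j := h2.1.symm.trans h1.2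
          simp [h1, hij, he hij]
        · rw [if_pos h1, if_neg h2, if_pos h1.symm, StarOp.hom_hom]
      · rw [if_neg h1, if_neg (fun h => h1 h.symm : ¬(q = j ∧ p = i))]
        by_cases h2 : p = j ∧ q = i
        · rw [if_pos h2, if_pos h2.symm]
        · rw [if_neg h2, if_neg (fun h => h2 h.symm), map_zero]
    obtain ⟨Y, hY, hYE⟩ := h E hE
    have habove : ∀ z, (i, j) < z → ∀ k, Y k z.1 z.2 = 0 :=
      eq_zero_of_isSeparated hF hG hY (U := Set.Ioi (i, j)) (isUpperSet_Ioi _) ih (by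
        rintro ⟨p, q⟩ (hz : (i, j) < (p, q)) k
        have h1 : ¬(p = i ∧ q = j) := by
          rintro ⟨rfl, rfl⟩
          exact lt_irrefl _ hz
        have h2 : ¬(p = j ∧ q = i) := by
          rintro ⟨rfl, rfl⟩
          obtain ⟨h, h'⟩ := Prod.mk_le_mk.1 hz.le
          exact h1 ⟨le_antisymm h' h, le_antisymm h h'⟩
        rw [hYE]
        simp [E, h1, h2])
    refine ⟨fun k => Y k i j, fun hij k => ?_, fun k => ?_⟩
    · have hij : i = j := hij
      simp only [hY k, StarOp.app_apply, hij]
    rw [← doubledOp_apply_of_blockTriangular (x := (i, j)) hF hG habove, hYE]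
    simp [E]

/-- Nonsingularity in terms of the diagonals of a generalized periodic Schur form. -/
theorem isNonsingularSystem_iff_isSeparated {A B C D : Fin r → Matrix (Fin n) (Fin n) ℂ}
    {P Q : Fin (r + r) → Matrix (Fin n) (Fin n) ℂ}
    (hP : ∀ k, (P k).det ≠ 0) (hQ : ∀ k, (Q k).det ≠ 0)
    (hF : ∀ k, (P k * starAppend s A B k * Q k).BlockTriangular id)
    (hG : ∀ k, (P k * starAppend s C D k * Q (k + 1)).BlockTriangular id) :
    IsNonsingularSystem s A B C D ↔ ∀ i j, IsSeparated s
      (fun i => ∏ k, (P k * starAppend s A B k * Q k) i i)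
      (fun i => ∏ k, (P k * starAppend s C D k * Q (k + 1)) i i) i j := by
  constructor
  · intro h i j
    exact isSeparated_of_doubledOp_surjective hF hG
      (fun E hE => doubledOp_surjective_congr hP hQ (fun E hE => h.surjective hE) hE) (i, j)
  · intro h
    refine isNonsingularSystem_of_injective fun Y hY h0 =>
      doubledOp_injective_of_congr (P := P) hQ (fun Y hY h0 => ?_) hY h0
    funext k
    ext i j
    exact eq_zero_of_isSeparated hF hG hY isUpperSet_univ (fun x _ => h x.1 x.2)
      (fun x _ k => by rw [h0]; rfl) (i, j) trivial k

end triangular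

end PeriodicSylvester
end

/-! ### From the binomial factors to the spectral conditions -/

noncomputable section
namespace PeriodicSylvester
open Polynomial

theorem mem_unityRoots_iff {N : ℕ} (hN : N ≠ 0) {z : ℂ} : z ∈ unityRoots N ↔ z ^ N = 1 := by
  have hprim := Complex.isPrimitiveRoot_exp N hN
  have e : ∀ j : ℕ, Complex.exp (2 * (Real.pi : ℂ) * Complex.I * (j : ℂ) / (N : ℂ)) =
      Complex.exp (2 * Real.pi * Complex.I / N) ^ j := by
    intro j
    rw [← Complex.exp_nat_mul]
    congr 1
    ring
  have : NeZero N := ⟨hN⟩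
  constructor
  · rintro ⟨j, -, rfl⟩
    rw [e, pow_right_comm, hprim.pow_eq_one, one_pow]
  · intro hz
    obtain ⟨j, hj, rfl⟩ := hprim.eq_pow_of_pow_eq_one hz
    exact ⟨j, hj, (e j).symm⟩

section reciprocal

theorem extInv_infty : extInv OnePoint.infty = ((0 : ℂ) : OnePoint ℂ) := rfl

theorem extInv_coe_zero : extInv ((0 : ℂ) : OnePoint ℂ) = OnePoint.infty := if_pos rfl

theorem extInv_coe {z : ℂ} (hz : z ≠ 0) : extInv (z : OnePoint ℂ) = ((z⁻¹ : ℂ) : OnePoint ℂ) :=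
  if_neg hz

theorem forall_ne_extInv_iff {S : Set (OnePoint ℂ)} {τ : OnePoint ℂ → OnePoint ℂ} {σ : ℂ →+* ℂ}
    (hinfty : τ OnePoint.infty = OnePoint.infty) (hcoe : ∀ z : ℂ, τ z = (σ z : ℂ)) :
    (∀ x ∈ S, ∀ y ∈ S, x ≠ extInv (τ y)) ↔
      ¬ (OnePoint.infty ∈ S ∧ ((0 : ℂ) : OnePoint ℂ) ∈ S) ∧
        ∀ z : ℂ, z ≠ 0 → (z : OnePoint ℂ) ∈ S → (((σ z)⁻¹ : ℂ) : OnePoint ℂ) ∉ S := by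
  constructor
  · intro h
    refine ⟨fun ⟨h1, h2⟩ => h _ h2 _ h1 ?_, fun z hz h1 h2 => h _ h2 _ h1 ?_⟩
    · rw [hinfty, extInv_infty]
    · rw [hcoe, extInv_coe ((map_ne_zero σ).2 hz)]
  · rintro ⟨h0, h⟩ x hx y hy rfl
    induction y using OnePoint.rec with
    | infty =>
      rw [hinfty, extInv_infty] at hx
      exact h0 ⟨hy, hx⟩
    | coe z =>
      rw [hcoe] at hx
      by_cases hz : z = 0
      · subst hz
        rw [map_zero, extInv_coe_zero] at hx
        exact h0 ⟨hx, hy⟩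
      · rw [extInv_coe ((map_ne_zero σ).2 hz)] at hx
        exact h z hz hy hx

theorem isReciprocalFree_iff {S : Set (OnePoint ℂ)} : IsReciprocalFree S ↔
    ¬ (OnePoint.infty ∈ S ∧ ((0 : ℂ) : OnePoint ℂ) ∈ S) ∧
      ∀ z : ℂ, z ≠ 0 → (z : OnePoint ℂ) ∈ S → ((z⁻¹ : ℂ) : OnePoint ℂ) ∉ S :=
  forall_ne_extInv_iff (τ := id) (σ := RingHom.id ℂ) rfl fun _ => rfl

theorem isHReciprocalFree_iff {S : Set (OnePoint ℂ)} : IsHReciprocalFree S ↔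
    ¬ (OnePoint.infty ∈ S ∧ ((0 : ℂ) : OnePoint ℂ) ∈ S) ∧
      ∀ z : ℂ, z ≠ 0 → (z : OnePoint ℂ) ∈ S →
        (((starRingEnd ℂ z)⁻¹ : ℂ) : OnePoint ℂ) ∉ S :=
  forall_ne_extInv_iff (τ := extConj) rfl fun _ => rfl

end reciprocal

section binomialProduct
variable {n N : ℕ} {a c : Fin n → ℂ} {κ : ℂ} {p : ℂ[X]}

theorem eval_binomialProduct (hp : p = C κ * ∏ i, (C (a i) * X ^ N + C (c i))) (z : ℂ) :
    p.eval z = κ * ∏ i, (a i * z ^ N + c i) := by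
  simp [hp, eval_prod]

theorem binomialProduct_ne_zero_iff (hκ : κ ≠ 0) (hN : N ≠ 0)
    (hp : p = C κ * ∏ i, (C (a i) * X ^ N + C (c i))) :
    p ≠ 0 ↔ ∀ i, ¬ (a i = 0 ∧ c i = 0) := by
  rw [hp, mul_ne_zero_iff, Finset.prod_ne_zero_iff]
  simp only [Finset.mem_univ, true_imp_iff, C_ne_zero, hκ, ne_eq, not_false_eq_true, true_and]
  refine forall_congr' fun i => not_congr ⟨fun h => ?_, fun ⟨h1, h2⟩ => by simp [h1, h2]⟩
  have h0 := congrArg (coeff · 0) h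
  have h1 := congrArg (coeff · N) h
  simp only [coeff_add, coeff_C_mul, coeff_X_pow, coeff_C, coeff_zero, hN, hN.symm, if_true,
    if_false, mul_zero, zero_add, mul_one, add_zero] at h0 h1
  exact ⟨h1, h0⟩

/-- The coefficient of `X ^ (n * N)` is `κ ∏ a_i`. -/
theorem degree_binomialProduct_lt_iff (hκ : κ ≠ 0) (hN : N ≠ 0)
    (hp : p = C κ * ∏ i, (C (a i) * X ^ N + C (c i))) :
    p.degree < (n * N : ℕ) ↔ ∃ i, a i = 0 := by
  have hdeg : ∀ i, (C (a i) * X ^ N + C (c i)).natDegree ≤ N := fun i =>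
    natDegree_add_le_of_degree_le (natDegree_C_mul_X_pow_le _ _) (by simp)
  have hle : p.natDegree ≤ n * N := by
    rw [hp]
    refine (natDegree_C_mul_le _ _).trans ((natDegree_prod_le _ _).trans ?_)
    refine (Finset.sum_le_card_nsmul _ _ N fun i _ => hdeg i).trans ?_
    simp
  have hcoeff : p.coeff (n * N) = κ * ∏ i, a i := by
    have := coeff_prod_of_natDegree_le (s := Finset.univ)
      (fun i => C (a i) * X ^ N + C (c i)) N fun i _ => hdeg i
    rw [Finset.card_univ, Fintype.card_fin] at this
    rw [hp, coeff_C_mul, this]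
    simp [coeff_C, hN]
  have key : p.degree < (n * N : ℕ) ↔ p.coeff (n * N) = 0 := by
    constructor
    · exact coeff_eq_zero_of_degree_lt
    · intro h
      refine lt_of_le_of_ne (degree_le_of_natDegree_le hle) fun h' => ?_
      exact coeff_ne_zero_of_eq_degree h' h
  rw [key, hcoeff, mul_eq_zero, or_iff_right hκ, Finset.prod_eq_zero_iff]
  simp

/-- At `ξ` each factor takes the value `a_i + c_i`, and a vanishing factor has a simple zero there
since `a_i ≠ 0` and `ξ ≠ 0`. Thus the criterion does not depend on the choice of root of unity. -/
theorem rootMultiplicity_binomialProduct_le_one_iff (hN : N ≠ 0)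
    (hp : p = C κ * ∏ i, (C (a i) * X ^ N + C (c i))) (hp0 : p ≠ 0) {ξ : ℂ} (hξ : ξ ^ N = 1) :
    p.rootMultiplicity ξ ≤ 1 ↔ ∀ i j, i ≠ j → ¬ (a i + c i = 0 ∧ a j + c j = 0) := by
  classical
  have hξ0 : ξ ≠ 0 := by
    rintro rfl
    simp [hN] at hξ
  have hroot : ∀ i, (C (a i) * X ^ N + C (c i)).eval ξ = a i + c i := fun i => by simp [hξ]
  rw [← not_lt, one_lt_rootMultiplicity_iff_isRoot hp0]
  constructor
  · rintro h i j hij ⟨hi, hj⟩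
    apply h
    have hj' : j ∈ Finset.univ.erase i := Finset.mem_erase.2 ⟨hij.symm, Finset.mem_univ _⟩
    rw [← Finset.mul_prod_erase _ _ (Finset.mem_univ i), ← Finset.mul_prod_erase _ _ hj'] at hp
    rw [← hroot] at hi hj
    rw [hp]
    constructor
    · simp only [IsRoot.def, eval_mul, hi, zero_mul, mul_zero]
    · simp only [IsRoot.def, derivative_mul, eval_mul, eval_add, hi, hj, zero_mul, mul_zero,
        add_zero]
  · rintro h ⟨h1, h2⟩
    have h1' : ∃ i, a i + c i = 0 := by
      rw [IsRoot.def, hp, eval_mul, eval_C, eval_prod, mul_eq_zero, Finset.prod_eq_zero_iff] at h1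
      rcases h1 with h1 | ⟨i, -, hi⟩
      · rw [h1, C_0, zero_mul] at hp
        exact absurd hp hp0
      · exact ⟨i, by rwa [hroot] at hi⟩
    obtain ⟨i, hi⟩ := h1'
    have hκ : κ ≠ 0 := by
      rintro rfl
      simp [hp] at hp0
    have ha : a i ≠ 0 := by
      intro ha
      have hc : c i = 0 := by rwa [ha, zero_add] at hi
      exact (binomialProduct_ne_zero_iff hκ hN hp).1 hp0 i ⟨ha, hc⟩
    rw [← Finset.mul_prod_erase _ _ (Finset.mem_univ i)] at hp
    rw [← hroot] at hi
    rw [hp, IsRoot.def, derivative_C_mul, derivative_mul, eval_mul, eval_add, eval_mul, eval_mul, hi,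
      zero_mul, add_zero, eval_C, eval_prod] at h2
    have hd : (derivative (C (a i) * X ^ N + C (c i))).eval ξ ≠ 0 := by
      simp [derivative_X_pow, ha, hN, hξ0]
    refine mul_ne_zero hκ (mul_ne_zero hd (Finset.prod_ne_zero_iff.2 fun j hj => ?_)) h2
    rw [hroot] at hi ⊢
    exact fun hj0 => h i j (Finset.ne_of_mem_erase hj).symm ⟨hi, hj0⟩

end binomialProduct

section spectrum
variable {n N : ℕ} {a c : Fin n → ℂ} {κ : ℂ} {ι : Type*} [Fintype ι] [DecidableEq ι]
  {M : Matrix ι ι ℂ[X]}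

theorem coe_mem_pencilSpectrum_iff (hκ : κ ≠ 0)
    (hM : M.det = C κ * ∏ i, (C (a i) * X ^ N + C (c i))) {z : ℂ} :
    (z : OnePoint ℂ) ∈ pencilSpectrum M ↔ ∃ i, a i * z ^ N + c i = 0 := by
  have hdet : (M.map (Polynomial.eval z)).det = M.det.eval z :=
    ((Polynomial.evalRingHom z).map_det M).symm
  have h : (∃ i, a i * z ^ N + c i = 0) ↔ (M.map (Polynomial.eval z)).det = 0 := by
    rw [hdet, eval_binomialProduct hM, mul_eq_zero, or_iff_right hκ, Finset.prod_eq_zero_iff]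
    simp
  rw [h]
  constructor
  · rintro (⟨w, hw, h⟩ | ⟨h, -⟩)
    · rwa [OnePoint.coe_injective hw]
    · exact absurd h (OnePoint.coe_ne_infty z)
  · exact fun h => Or.inl ⟨z, rfl, h⟩

theorem infty_mem_pencilSpectrum_iff (hκ : κ ≠ 0) (hN : N ≠ 0) (hcard : Fintype.card ι = n * N)
    (hM : M.det = C κ * ∏ i, (C (a i) * X ^ N + C (c i))) :
    OnePoint.infty ∈ pencilSpectrum M ↔ ∃ i, a i = 0 := by
  rw [← degree_binomialProduct_lt_iff hκ hN hM, ← hcard]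
  constructor
  · rintro (⟨w, hw, -⟩ | ⟨-, h⟩)
    · exact absurd hw (OnePoint.infty_ne_coe w)
    · exact h
  · exact fun h => Or.inr ⟨rfl, h⟩

end spectrum

section separation
variable {n N : ℕ} {a c : Fin n → ℂ} (s : StarOp)

theorem mul_hom_eq_of_reciprocal_roots {i j : Fin n} {z : ℂ} (hz : z ≠ 0)
    (hi : a i * z ^ N + c i = 0) (hj : a j * (s.hom z)⁻¹ ^ N + c j = 0) :
    a i * s.hom (a j) = c i * s.hom (c j) := by
  have hz' : s.hom z ≠ 0 := (_root_.map_ne_zero _).2 hz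
  rw [inv_pow] at hj
  have hj1 : a j = -(c j * s.hom z ^ N) := by
    field_simp at hj
    linear_combination hj
  have hi1 : c i = -(a i * z ^ N) := by linear_combination hi
  rw [hj1, hi1]
  simp only [map_neg, map_mul, map_pow, StarOp.hom_hom]
  ring

/-- Converse of `mul_hom_eq_of_reciprocal_roots`: regularity and the exclusion of the pair `0, ∞`
force `a i`, `a j`, `c i` to be nonzero, and then any `N`-th root of `-c i / a i` serves as `z`. -/
theorem exists_reciprocal_roots (hN : N ≠ 0) (hreg : ∀ i, ¬ (a i = 0 ∧ c i = 0))
    (hinf : ¬ ((∃ i, a i = 0) ∧ ∃ j, c j = 0)) {i j : Fin n}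
    (h : a i * s.hom (a j) = c i * s.hom (c j)) :
    ∃ z : ℂ, z ≠ 0 ∧ a i * z ^ N + c i = 0 ∧ a j * (s.hom z)⁻¹ ^ N + c j = 0 := by
  have hai : a i ≠ 0 := by
    intro hai
    rw [hai, zero_mul, eq_comm, mul_eq_zero, _root_.map_eq_zero] at h
    exact h.elim (fun h => hreg i ⟨hai, h⟩) fun h => hinf ⟨⟨i, hai⟩, j, h⟩
  have haj : a j ≠ 0 := by
    intro haj
    rw [haj, map_zero, mul_zero, eq_comm, mul_eq_zero, _root_.map_eq_zero] at h
    exact h.elim (fun h => hinf ⟨⟨j, haj⟩, i, h⟩) fun h => hreg j ⟨haj, h⟩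
  have hci : c i ≠ 0 := by
    intro hci
    rw [hci, zero_mul] at h
    exact mul_ne_zero hai ((_root_.map_ne_zero _).2 haj) h
  obtain ⟨z, hz⟩ := IsAlgClosed.exists_pow_nat_eq (-c i / a i) (Nat.pos_of_ne_zero hN)
  refine ⟨z, ?_, by rw [hz]; field_simp; ring, ?_⟩
  · rintro rfl
    rw [zero_pow hN, eq_comm, div_eq_zero_iff, neg_eq_zero] at hz
    exact hz.elim hci hai
  · have h' := congrArg s.hom h
    simp only [map_mul, StarOp.hom_hom] at h'
    have hci' : s.hom (c i) ≠ 0 := (_root_.map_ne_zero _).2 hci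
    rw [inv_pow, ← map_pow, hz, map_div₀, map_neg]
    field_simp
    linear_combination -h'

theorem forall_isSeparated_conjTranspose_iff (hN : N ≠ 0) :
    (∀ i j, IsSeparated .conjTranspose a c i j) ↔ (∀ i, ¬ (a i = 0 ∧ c i = 0)) ∧
      ¬ ((∃ i, a i = 0) ∧ ∃ j, c j = 0) ∧
      ∀ z : ℂ, z ≠ 0 → (∃ i, a i * z ^ N + c i = 0) →
        ¬ ∃ j, a j * (starRingEnd ℂ z)⁻¹ ^ N + c j = 0 := by
  have hsep : ∀ i j, IsSeparated .conjTranspose a c i j ↔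
      a i * StarOp.conjTranspose.hom (a j) ≠ c i * StarOp.conjTranspose.hom (c j) := by
    intro i j
    simp [IsSeparated]
  simp only [hsep]
  constructor
  · intro h
    refine ⟨fun i ⟨h1, h2⟩ => h i i (by simp [h1, h2]),
      fun ⟨⟨i, hi⟩, j, hj⟩ => h i j (by simp [hi, hj]), ?_⟩
    rintro z hz ⟨i, hi⟩ ⟨j, hj⟩
    exact h i j (mul_hom_eq_of_reciprocal_roots .conjTranspose hz hi hj)
  · rintro ⟨hreg, hinf, hfin⟩ i j h
    obtain ⟨z, hz, hi, hj⟩ := exists_reciprocal_roots .conjTranspose hN hreg hinf h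
    exact hfin z hz ⟨i, hi⟩ ⟨j, hj⟩

/-- Reciprocal freeness alone would demand `a_i² ≠ c_i²`, whereas only `a_i ≠ c_i` is needed. The
permitted case `a_i = -c_i` is the factor with roots `z ^ N = 1`, hence the exemption of these
roots. Two such factors at `i ≠ j` would give `a_i a_j = c_i c_j`, hence the multiplicity bound. -/
theorem forall_isSeparated_transpose_iff (hN : N ≠ 0) :
    (∀ i j, IsSeparated .transpose a c i j) ↔ (∀ i, ¬ (a i = 0 ∧ c i = 0)) ∧
      (¬ ((∃ i, a i = 0) ∧ ∃ j, c j = 0) ∧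
      ∀ z : ℂ, z ≠ 0 → z ^ N ≠ 1 → (∃ i, a i * z ^ N + c i = 0) →
        ¬ ∃ j, a j * z⁻¹ ^ N + c j = 0) ∧
      ∀ i j, i ≠ j → ¬ (a i + c i = 0 ∧ a j + c j = 0) := by
  have hsep : ∀ i j, IsSeparated .transpose a c i j ↔
      (i = j → a i ≠ c i) ∧ (i ≠ j → a i * a j ≠ c i * c j) := by
    intro i j
    simp [IsSeparated, StarOp.hom]
  simp only [hsep]
  constructor
  · intro h
    have hd : ∀ i, a i ≠ c i := fun i => (h i i).1 rfl
    have ho : ∀ i j, i ≠ j → a i * a j ≠ c i * c j := fun i j => (h i j).2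
    have hreg : ∀ i, ¬ (a i = 0 ∧ c i = 0) := fun i ⟨h1, h2⟩ => hd i (h1.trans h2.symm)
    refine ⟨hreg, ⟨?_, ?_⟩, ?_⟩
    · rintro ⟨⟨i, hi⟩, j, hj⟩
      by_cases hij : i = j
      · exact hreg i ⟨hi, hij ▸ hj⟩
      · exact ho i j hij (by simp [hi, hj])
    · rintro z hz hz1 ⟨i, hi⟩ ⟨j, hj⟩
      have hprod : a i * a j = c i * c j := mul_hom_eq_of_reciprocal_roots .transpose hz hi hj
      by_cases hij : i = j
      · subst hij
        have hsum : (a i - c i) * (a i + c i) = 0 := by linear_combination hprod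
        have hc : a i + c i = 0 := (mul_eq_zero.1 hsum).resolve_left (sub_ne_zero.2 (hd i))
        have hz2 : a i * (z ^ N - 1) = 0 := by linear_combination hi - hc
        rcases mul_eq_zero.1 hz2 with ha | hz2
        · exact hreg i ⟨ha, by rwa [ha, zero_add] at hc⟩
        · exact hz1 (sub_eq_zero.1 hz2)
      · exact ho i j hij hprod
    · rintro i j hij ⟨hi, hj⟩
      refine ho i j hij ?_
      rw [eq_neg_of_add_eq_zero_left hi, eq_neg_of_add_eq_zero_left hj, neg_mul_neg]
  · rintro ⟨hreg, ⟨hinf, hfin⟩, hmult⟩ i j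
    have key : a i * a j = c i * c j → a i + c i = 0 ∧ a j + c j = 0 := by
      intro h
      obtain ⟨z, hz, hi, hj⟩ := exists_reciprocal_roots .transpose hN hreg hinf h
      have hz1 : z ^ N = 1 := by
        by_contra hz1
        exact hfin z hz hz1 ⟨i, hi⟩ ⟨j, hj⟩
      change a j * z⁻¹ ^ N + c j = 0 at hj
      rw [inv_pow, hz1, inv_one, mul_one] at hj
      rw [hz1, mul_one] at hi
      exact ⟨hi, hj⟩
    constructor
    · rintro rfl h
      have h0 := (key (by rw [h])).1
      rw [← h, add_self_eq_zero] at h0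
      exact hreg i ⟨h0, h ▸ h0⟩
    · exact fun hij h => hmult i j hij (key h)

end separation

section conditions
variable {n N : ℕ} {a c : Fin n → ℂ} {κ : ℂ} {ι : Type*} [Fintype ι] [DecidableEq ι]
  {M : Matrix ι ι ℂ[X]}

theorem isHReciprocalFree_pencilSpectrum_iff (hκ : κ ≠ 0) (hN : N ≠ 0)
    (hcard : Fintype.card ι = n * N) (hM : M.det = C κ * ∏ i, (C (a i) * X ^ N + C (c i))) :
    IsRegularPencil M ∧ IsHReciprocalFree (pencilSpectrum M) ↔
      ∀ i j, IsSeparated .conjTranspose a c i j := by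
  rw [forall_isSeparated_conjTranspose_iff hN, isHReciprocalFree_iff, IsRegularPencil,
    binomialProduct_ne_zero_iff hκ hN hM, infty_mem_pencilSpectrum_iff hκ hN hcard hM]
  simp only [coe_mem_pencilSpectrum_iff hκ hM, zero_pow hN, mul_zero, zero_add]

theorem isReciprocalFree_pencilSpectrum_iff (hκ : κ ≠ 0) (hN : N ≠ 0)
    (hcard : Fintype.card ι = n * N) (hM : M.det = C κ * ∏ i, (C (a i) * X ^ N + C (c i))) :
    IsRegularPencil M ∧
      (IsReciprocalFree (pencilSpectrum M \ (fun z : ℂ => (z : OnePoint ℂ)) '' unityRoots N) ∧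
        ∀ ξ ∈ unityRoots N, pencilMultiplicity M ξ ≤ 1) ↔
      ∀ i j, IsSeparated .transpose a c i j := by
  rw [forall_isSeparated_transpose_iff hN, IsRegularPencil,
    ← binomialProduct_ne_zero_iff hκ hN hM]
  refine and_congr_right fun hreg => and_congr ?_ ?_
  · have hinfty : OnePoint.infty ∉ (fun z : ℂ => (z : OnePoint ℂ)) '' unityRoots N := by
      rintro ⟨z, -, hz⟩
      exact OnePoint.coe_ne_infty z hz
    have hcoe : ∀ z : ℂ, (z : OnePoint ℂ) ∈ (fun z : ℂ => (z : OnePoint ℂ)) '' unityRoots N ↔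
        z ^ N = 1 := fun z => by
      rw [OnePoint.coe_injective.mem_set_image, mem_unityRoots_iff hN]
    simp only [isReciprocalFree_iff, Set.mem_sdiff, hinfty, hcoe,
      infty_mem_pencilSpectrum_iff hκ hN hcard hM, coe_mem_pencilSpectrum_iff hκ hM, zero_pow hN,
      mul_zero, zero_add, zero_ne_one, not_false_eq_true, and_true, inv_pow, inv_eq_one]
    refine and_congr_right fun _ => forall₂_congr fun z _ => ?_
    tauto
  -- The bound at `ξ = 1` already yields the condition on the factors, which in turn gives it at
  -- every root of unity.
  · constructor
    · intro h
      exact (rootMultiplicity_binomialProduct_le_one_iff hN hM hreg (one_pow N)).1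
        (h 1 ((mem_unityRoots_iff hN).2 (one_pow N)))
    · intro h ξ hξ
      exact (rootMultiplicity_binomialProduct_le_one_iff hN hM hreg
        ((mem_unityRoots_iff hN).1 hξ)).2 h

end conditions

end PeriodicSylvester
end

theorem theorem4p3 (n r : ℕ) (hr : 1 ≤ r) (s : PeriodicSylvester.StarOp)
    (A B C D : Fin r → Matrix (Fin n) (Fin n) ℂ) :
    PeriodicSylvester.IsNonsingularSystem s A B C D ↔
      PeriodicSylvester.IsRegularPencil (PeriodicSylvester.blockPencil s A B C D) ∧
      (s = PeriodicSylvester.StarOp.conjTranspose →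
        PeriodicSylvester.IsHReciprocalFree
          (PeriodicSylvester.pencilSpectrum (PeriodicSylvester.blockPencil s A B C D))) ∧
      (s = PeriodicSylvester.StarOp.transpose →
        PeriodicSylvester.IsReciprocalFree
          (PeriodicSylvester.pencilSpectrum (PeriodicSylvester.blockPencil s A B C D) \
            (fun z : ℂ => (z : OnePoint ℂ)) '' PeriodicSylvester.unityRoots (2 * r)) ∧
        ∀ ξ ∈ PeriodicSylvester.unityRoots (2 * r),
          PeriodicSylvester.pencilMultiplicity
            (PeriodicSylvester.blockPencil s A B C D) ξ ≤ 1) := by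
  open PeriodicSylvester in
  have : NeZero r := ⟨by omega⟩
  have hN : 2 * r ≠ 0 := by omega
  have hcard : Fintype.card (Fin (r + r) × Fin n) = n * (2 * r) := by
    rw [Fintype.card_prod, Fintype.card_fin, Fintype.card_fin, two_mul, mul_comm]
  obtain ⟨P, Q, hP, hQ, hF, hG⟩ := exists_triangular (starAppend s A B) (starAppend s C D)
  obtain ⟨κ, hκ, hdet⟩ := det_blockPencil s A B C D hP hQ hF hG
  rw [isNonsingularSystem_iff_isSeparated hP hQ hF hG]
  cases s with
  | transpose =>
    rw [← isReciprocalFree_pencilSpectrum_iff hκ hN hcard hdet]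
    simp only [reduceCtorEq, false_imp_iff, true_imp_iff, true_and]
  | conjTranspose =>
    rw [← isHReciprocalFree_pencilSpectrum_iff hκ hN hcard hdet]
    simp only [reduceCtorEq, false_imp_iff, true_imp_iff, and_true]
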